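/- Let $\mathbb K$ be a (super)commutative $\mathbb Q$-superalgebra, let $\mathfrak g$ be a Lie superalgebra over $\mathbb K$, and let $\mathfrak h\subset\mathfrak g$ be a Lie subalgebra over $\mathbb K$ that is a direct factor, i.e. $\mathfrak g=\mathfrak h\oplus\mathfrak q$ for some graded $\mathbb K$-submodule $\mathfrak q$. All modules are $\mathbb Z/2$-graded, $p$ denotes parity, a left $\mathbb K$-module is also a right one by $mk=(-1)^{p(m)p(k)}km$, and formulas with signs are written for homogeneous elements and extended additively. Let $U(\mathfrak g)$ be the enveloping algebra of $\mathfrak g$ over $\mathbb K$, let $j:\mathfrak g\to U(\mathfrak g)$ be the canonical map, $\Delta$ the coproduct ($\Delta(j(a))=j(a)\otimes1+1\otimes j(a)$) and $S$ the antipode, i.e. the even $\mathbb K$-linear map with $S(1)=1$, $S(j(a))=-j(a)$ for $a\in\mathfrak g$ and $S(uw)=(-1)^{p(u)p(w)}S(w)S(u)$. For a $\mathbb K$-module $N$, let $F(G,N)=\operatorname{Hom}_{\mathbb K}(U(\mathfrak g),N)$ be the set of all right $\mathbb K$-linear maps (even, odd, and their sums). With the product dual to $\Delta$, $F(G):=F(G,\mathbb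 K)$ is a superalgebra and $F(G,N)$ is an $F(G)$-module. The Lie superalgebra $\mathfrak g$ acts on $F(G,N)$ by $$(a f)(u)=-(-1)^{p(a)p(f)}f(j(a)u).$$ Let $F(G/H)\subset F(G)$ be the $\mathfrak g$-stable subalgebra of those $f$ that vanish on $U(\mathfrak g)j(\mathfrak h)$. For an $\mathfrak h$-module $V$, let the coinduced module $F(G/H,V)\subset F(G,V)$ consist of those $f$ that satisfy $$a(f(u))=-(-1)^{p(a)p(f(u))}f(uj(a))\qquad\text{for all }a\in\mathfrak h,\ u\in U(\mathfrak g);$$ it is stable under the action of $\mathfrak g$ and under multiplication by $F(G/H)$. A $\mathfrak g$-$F(G/H)$-module is a $\mathbb K$-module $\mathcal V$ with compatible structures of an $F(G/H)$-module and of a $\mathfrak g$-module such that $$a(\phi v)=(a\phi)v+(-1)^{p(a)p(\phi)}\phi(av)\qquad\text{for }a\in\mathfrak g,\ \phi\in F(G/H),\ v\in\mathcal V.$$ Let $\delta:F(G/H)\to\mathbb K$, $\delta(f)=f(1)$, and $$V_{\mathcal V}=\mathcal V\otimes_{F(G/H)}\mathbb K=\mathcal V/(\ker\delta)\mathcal V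 ,$$ where $F(G/H)$ acts on $\mathbb K$ through $\delta$. Let $\bar\delta:\mathcal V\to V_{\mathcal V}$ be the quotient map. Its kernel is stable under $\mathfrak h$, so that $V_{\mathcal V}$ is an $\mathfrak h$-module. **Proposition (imprimitivity).** Let $\mathcal V$ be a $\mathfrak g$-$F(G/H)$-module that is free of finite rank over $F(G/H)$, that is, it has a finite basis over $F(G/H)$ that consists of homogeneous elements. Then the formula $$\tilde\delta(v)(u)=(-1)^{p(u)p(v)}\,\bar\delta\bigl(S(u)v\bigr)\qquad(v\in\mathcal V,\ u\in U(\mathfrak g))$$ defines an isomorphism of $\mathfrak g$-$F(G/H)$-modules $$\tilde\delta:\mathcal V\to F(G/H,V_{\mathcal V}),$$ that is, $\tilde\delta$ takes values in $F(G/H,V_{\mathcal V})$, is bijective and even, is linear over $\mathbb K$ and over $F(G/H)$, and commutes with the actions of $\mathfrak g$. -/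

import Mathlib

namespace SuperLie

set_option linter.unusedSectionVars false

/-- The Koszul sign `(-1)^(i j)`. -/
def ks (i j : ZMod 2) : ℤ := if i = 1 ∧ j = 1 then -1 else 1

theorem ks_comm : ∀ i j : ZMod 2, ks i j = ks j i := by decide
theorem ks_mul_self : ∀ i j : ZMod 2, ks i j * ks i j = 1 := by decide
theorem ks_add_left : ∀ i j l : ZMod 2, ks (i + j) l = ks i l * ks j l := by decide
theorem ks_add_right : ∀ i j l : ZMod 2, ks i (j + l) = ks i j * ks i l := by decide
theorem ks_zero_left : ∀ i : ZMod 2, ks 0 i = 1 := by decide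
theorem ks_zero_right : ∀ i : ZMod 2, ks i 0 = 1 := by decide
theorem ks_eq : ∀ i j : ZMod 2, (((-1 : ℤˣ) ^ (i * j) : ℤˣ) : ℤ) = ks i j := by decide

/-- A `ℤ/2`-grading `M = M₀ ⊕ M₁` of an abelian group. -/
class SuperGraded (M : Type*) [AddCommGroup M] where
  gr : ZMod 2 → Submodule ℤ M
  isCompl : IsCompl (gr 0) (gr 1)

/-- The elements of `M` that are homogeneous of parity `i`. -/
def gr (M : Type*) [AddCommGroup M] [SuperGraded M] (i : ZMod 2) : Submodule ℤ M :=
  SuperGraded.gr i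

noncomputable instance decompositionGr (M : Type*) [AddCommGroup M] [SuperGraded M] :
    DirectSum.Decomposition (gr M) :=
  DirectSum.IsInternal.chooseDecomposition _
    ((DirectSum.isInternal_submodule_iff_isCompl (gr M) (i := 0) (j := 1) (by decide)
      (by ext i; revert i; decide)).2 SuperGraded.isCompl)

section Graded
variable {M : Type*} [AddCommGroup M] [SuperGraded M]

/-- The homogeneous component of parity `i`. -/
noncomputable def comp (i : ZMod 2) : M →+ M where
  toFun m := (DirectSum.decompose (gr M) m i : M)
  map_zero' := by simp
  map_add' := by simp

theorem comp_mem (i : ZMod 2) (m : M) : comp i m ∈ gr M i := SetLike.coe_mem _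

theorem comp_of_mem {i : ZMod 2} {m : M} (h : m ∈ gr M i) (j : ZMod 2) :
    comp j m = if i = j then m else 0 := by
  split_ifs with hij
  · subst hij; exact DirectSum.decompose_of_mem_same _ h
  · exact DirectSum.decompose_of_mem_ne _ h hij

theorem comp_add_comp (m : M) : comp 0 m + comp 1 m = m := by
  obtain ⟨a, ha, b, hb, rfl⟩ : ∃ a ∈ gr M 0, ∃ b ∈ gr M 1, a + b = m := by
    have : m ∈ gr M 0 ⊔ gr M 1 := by
      rw [show gr M 0 ⊔ gr M 1 = ⊤ from SuperGraded.isCompl.sup_eq_top]; trivial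
    simpa [Submodule.mem_sup] using this
  simp [comp_of_mem ha, comp_of_mem hb]

theorem homog_induction {P : M → Prop} (hom : ∀ i, ∀ m ∈ gr M i, P m)
    (add : ∀ m n, P m → P n → P (m + n)) (m : M) : P m := by
  rw [← comp_add_comp m]
  exact add _ _ (hom 0 _ (comp_mem _ _)) (hom 1 _ (comp_mem _ _))

/-- The map `m ↦ (-1)^(i p(m)) m`. -/
noncomputable def twist (i : ZMod 2) : M →+ M := comp 0 + ks i 1 • comp 1

theorem twist_of_mem (i : ZMod 2) {j : ZMod 2} {m : M} (h : m ∈ gr M j) :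
    twist i m = ks i j • m := by
  have hj : ∀ j : ZMod 2, j = 0 ∨ j = 1 := by decide
  obtain rfl | rfl := hj j
  · simp [twist, comp_of_mem h, ks_zero_right]
  · simp [twist, comp_of_mem h]

theorem twist_mem (i : ZMod 2) {j : ZMod 2} {m : M} (h : m ∈ gr M j) :
    twist i m ∈ gr M j := by
  rw [twist_of_mem i h]; exact Submodule.smul_mem _ _ h

theorem twist_zero (m : M) : twist 0 m = m := by
  simp [twist, ks_zero_left, comp_add_comp]

theorem twist_add (i j : ZMod 2) (m : M) : twist (i + j) m = twist i (twist j m) := by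
  induction m using homog_induction with
  | hom l m h =>
    rw [twist_of_mem _ h, twist_of_mem _ h, map_zsmul, twist_of_mem _ h, smul_smul, ks_add_left,
      mul_comm]
  | add m n hm hn => simp only [map_add, hm, hn]

theorem twist_twist (i : ZMod 2) (m : M) : twist i (twist i m) = m := by
  rw [← twist_add, show i + i = 0 by revert i; decide, twist_zero]

theorem hom_ext_homog {N : Type*} [AddCommGroup N] {f g : M →+ N}
    (h : ∀ i, ∀ m ∈ gr M i, f m = g m) : f = g := by
  ext m
  induction m using homog_induction with
  | hom i m hm => exact h i m hm
  | add m n hm hn => simp only [map_add, hm, hn]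

/-- An abelian group that is the sum of its even and odd part, with trivial intersection. -/
theorem isCompl_of {M : Type*} [AddCommGroup M] {p q : Submodule ℤ M}
    (h1 : ∀ m, ∃ a ∈ p, ∃ b ∈ q, a + b = m) (h2 : ∀ m ∈ p, m ∈ q → m = 0) : IsCompl p q := by
  refine ⟨Submodule.disjoint_def.2 h2, codisjoint_iff.2 ?_⟩
  rw [Submodule.eq_top_iff']
  intro m
  obtain ⟨a, ha, b, hb, h⟩ := h1 m
  exact Submodule.mem_sup.2 ⟨a, ha, b, hb, h⟩

end Graded

/-- `K` is a (super)commutative superalgebra. -/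
class SuperCommRing (K : Type*) [Ring K] [SuperGraded K] : Prop where
  one_mem : (1 : K) ∈ gr K 0
  mul_mem : ∀ {i j : ZMod 2} {a b : K}, a ∈ gr K i → b ∈ gr K j → a * b ∈ gr K (i + j)
  comm : ∀ {i j : ZMod 2} {a b : K}, a ∈ gr K i → b ∈ gr K j → a * b = ks i j • (b * a)

/-- `M` is a (graded) `K`-module. We use left modules, the right action being
`m k = (-1)^(p(k) p(m)) k m`. -/
class SuperModule (K M : Type*) [Ring K] [SuperGraded K] [AddCommGroup M] [SuperGraded M]
    [Module K M] : Prop where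
  smul_mem : ∀ {i j : ZMod 2} {k : K} {m : M}, k ∈ gr K i → m ∈ gr M j → k • m ∈ gr M (i + j)

section Module
variable {K M : Type*} [Ring K] [SuperGraded K] [SuperCommRing K] [AddCommGroup M] [SuperGraded M]
  [Module K M] [SuperModule K M]

instance : SuperModule K K := ⟨SuperCommRing.mul_mem⟩

/-- The right action `m k = (-1)^(p(k) p(m)) k m`. -/
noncomputable def rsmul (m : M) (k : K) : M := ∑ i, comp i k • twist i m

theorem rsmul_add (m : M) (k l : K) : rsmul m (k + l) = rsmul m k + rsmul m l := by
  simp [rsmul, add_smul, Finset.sum_add_distrib]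

theorem add_rsmul (m n : M) (k : K) : rsmul (m + n) k = rsmul m k + rsmul n k := by
  simp [rsmul, Finset.sum_add_distrib]

theorem neg_rsmul (m : M) (k : K) : rsmul (-m) k = - rsmul m k := by
  simp [rsmul]

theorem rsmul_homog {i j : ZMod 2} {m : M} {k : K} (hm : m ∈ gr M i) (hk : k ∈ gr K j) :
    rsmul m k = ks i j • k • m := by
  have : ∀ l, comp l k • twist l m = if j = l then ks i j • k • m else 0 := by
    intro l
    rw [comp_of_mem hk]
    split_ifs with h
    · rw [twist_of_mem _ hm, smul_comm, ← h, ks_comm]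
    · simp
  simp [rsmul, this]

theorem rsmul_twist (m : M) {j : ZMod 2} {k : K} (hk : k ∈ gr K j) :
    rsmul m k = k • twist j m := by
  induction m using homog_induction with
  | hom i m hm => rw [rsmul_homog hm hk, twist_of_mem _ hm, smul_comm, ks_comm]
  | add m n hm hn => rw [add_rsmul, map_add, smul_add, hm, hn]

theorem rsmul_mem {i j : ZMod 2} {m : M} {k : K} (hm : m ∈ gr M i) (hk : k ∈ gr K j) :
    rsmul m k ∈ gr M (i + j) := by
  rw [rsmul_homog hm hk, add_comm]
  exact Submodule.smul_mem _ _ (SuperModule.smul_mem hk hm)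

theorem smul_rsmul (k : K) (m : M) (l : K) : rsmul (k • m) l = k • rsmul m l := by
  induction l using homog_induction with
  | add a b ha hb => rw [rsmul_add, ha, hb, rsmul_add, smul_add]
  | hom j l hl =>
  induction k using homog_induction with
  | add a b ha hb => rw [add_smul, add_rsmul, ha, hb, add_smul]
  | hom i k hk =>
  induction m using homog_induction with
  | add a b ha hb => rw [smul_add, add_rsmul, ha, hb, add_rsmul, smul_add]
  | hom n m hm =>
  rw [rsmul_homog (SuperModule.smul_mem hk hm) hl, rsmul_homog hm hl, smul_smul l k,
    SuperCommRing.comm hl hk, smul_comm k, smul_smul k l, smul_assoc, smul_smul, ks_add_left,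
    mul_comm, ← mul_assoc, ks_comm j i, ks_mul_self, one_mul]

theorem rsmul_eq_mul (k l : K) : rsmul k l = k * l := by
  induction l using homog_induction with
  | add a b ha hb => rw [rsmul_add, ha, hb, mul_add]
  | hom j l hl =>
  induction k using homog_induction with
  | add a b ha hb => rw [add_rsmul, ha, hb, add_mul]
  | hom i k hk => rw [rsmul_homog hk hl, SuperCommRing.comm hk hl, smul_eq_mul]

theorem twist_smul (i : ZMod 2) (k : K) (m : M) : twist i (k • m) = twist i k • twist i m := by
  induction k using homog_induction with
  | add a b ha hb => rw [add_smul, map_add, ha, hb, map_add, add_smul]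
  | hom j k hk =>
  induction m using homog_induction with
  | add a b ha hb => rw [smul_add, map_add, ha, hb, map_add, smul_add]
  | hom l m hm =>
  rw [twist_of_mem _ (SuperModule.smul_mem hk hm), twist_of_mem _ hk, twist_of_mem _ hm,
    ks_add_right, smul_assoc, smul_comm k, smul_smul]

theorem twist_rsmul (i : ZMod 2) (m : M) (k : K) :
    twist i (rsmul m k) = rsmul (twist i m) (twist i k) := by
  induction k using homog_induction with
  | add a b ha hb => simp only [rsmul_add, map_add, ha, hb]
  | hom j k hk =>
  rw [rsmul_twist _ hk, rsmul_twist _ (twist_mem i hk), twist_smul, ← twist_add, ← twist_add,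
    add_comm]

theorem twist_one (i : ZMod 2) : twist i (1 : K) = 1 := by
  rw [twist_of_mem _ SuperCommRing.one_mem, ks_zero_right, one_smul]

theorem twist_mul (i : ZMod 2) (k l : K) : twist i (k * l) = twist i k * twist i l :=
  twist_smul i k l

end Module

/-- A Lie superalgebra over `K`. -/
class LieSuperalgebra (K 𝔤 : Type*) [Ring K] [SuperGraded K] [AddCommGroup 𝔤] [SuperGraded 𝔤]
    [Module K 𝔤] extends SuperModule K 𝔤 where
  br : 𝔤 →+ 𝔤 →+ 𝔤
  br_mem : ∀ {i j : ZMod 2} {a b : 𝔤}, a ∈ gr 𝔤 i → b ∈ gr 𝔤 j → br a b ∈ gr 𝔤 (i + j)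
  smul_br : ∀ (k : K) (a b : 𝔤), br (k • a) b = k • br a b
  skew : ∀ {i j : ZMod 2} {a b : 𝔤}, a ∈ gr 𝔤 i → b ∈ gr 𝔤 j → br a b = -(ks i j • br b a)
  jacobi : ∀ {i j : ZMod 2} {a b : 𝔤} (c : 𝔤), a ∈ gr 𝔤 i → b ∈ gr 𝔤 j →
    br a (br b c) = br (br a b) c + ks i j • br b (br a c)

/-- A module over a Lie superalgebra `𝔤` over `K`: the operators `act a` are `K`-linear in the
graded sense, and `act` is an even morphism of Lie superalgebras. -/
class LieSuperModule (K 𝔤 M : Type*) [Ring K] [SuperGraded K] [AddCommGroup 𝔤] [SuperGraded 𝔤]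
    [Module K 𝔤] [LieSuperalgebra K 𝔤] [AddCommGroup M] [SuperGraded M] [Module K M]
    [SuperModule K M] where
  act : 𝔤 →+ M →+ M
  act_mem : ∀ {i j : ZMod 2} {a : 𝔤} {m : M}, a ∈ gr 𝔤 i → m ∈ gr M j → act a m ∈ gr M (i + j)
  smul_act : ∀ (k : K) (a : 𝔤) (m : M), act (k • a) m = k • act a m
  act_smul : ∀ {i j : ZMod 2} {k : K} {a : 𝔤} (m : M), k ∈ gr K i → a ∈ gr 𝔤 j →
    act a (k • m) = ks i j • k • act a m
  br_act : ∀ {i j : ZMod 2} {a b : 𝔤} (m : M), a ∈ gr 𝔤 i → b ∈ gr 𝔤 j →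
    act (LieSuperalgebra.br K a b) m = act a (act b m) - ks i j • act b (act a m)


section Enveloping
variable (K 𝔤 : Type*) [Ring K] [SuperGraded K] [AddCommGroup 𝔤] [SuperGraded 𝔤]
  [Module K 𝔤] [LieSuperalgebra K 𝔤]

/-- The relations of the enveloping algebra, on the free ring generated by `K` and `𝔤`. -/
inductive URel : FreeRing (K ⊕ 𝔤) → FreeRing (K ⊕ 𝔤) → Prop
  | one : URel (FreeRing.of (.inl 1)) 1
  | add (k l : K) : URel (FreeRing.of (.inl (k + l))) (FreeRing.of (.inl k) + FreeRing.of (.inl l))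
  | mul (k l : K) : URel (FreeRing.of (.inl (k * l))) (FreeRing.of (.inl k) * FreeRing.of (.inl l))
  | add' (a b : 𝔤) :
      URel (FreeRing.of (.inr (a + b))) (FreeRing.of (.inr a) + FreeRing.of (.inr b))
  | smul (k : K) (a : 𝔤) :
      URel (FreeRing.of (.inr (k • a))) (FreeRing.of (.inl k) * FreeRing.of (.inr a))
  | comm {i j : ZMod 2} {a : 𝔤} {k : K} (ha : a ∈ gr 𝔤 i) (hk : k ∈ gr K j) :
      URel (FreeRing.of (.inr a) * FreeRing.of (.inl k))
        (ks i j • (FreeRing.of (.inl k) * FreeRing.of (.inr a)))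
  | br {i j : ZMod 2} {a b : 𝔤} (ha : a ∈ gr 𝔤 i) (hb : b ∈ gr 𝔤 j) :
      URel (FreeRing.of (.inr (LieSuperalgebra.br K a b)))
        (FreeRing.of (.inr a) * FreeRing.of (.inr b)
          - ks i j • (FreeRing.of (.inr b) * FreeRing.of (.inr a)))

/-- The enveloping algebra `U(𝔤)` of a Lie superalgebra over `K`: the universal associative
`K`-superalgebra with an even `K`-linear map `j` from `𝔤` such that
`j [a, b] = j a * j b - (-1)^(p(a) p(b)) j b * j a`. -/
def U : Type _ := RingQuot (URel K 𝔤)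

noncomputable instance : Ring (U K 𝔤) := inferInstanceAs (Ring (RingQuot (URel K 𝔤)))

namespace U

/-- The unit map `K → U(𝔤)`. -/
noncomputable def ι : K →+* U K 𝔤 where
  toFun k := RingQuot.mkRingHom (URel K 𝔤) (FreeRing.of (.inl k))
  map_one' := (RingQuot.mkRingHom_rel URel.one).trans (map_one _)
  map_mul' k l := (RingQuot.mkRingHom_rel (URel.mul k l)).trans (map_mul _ _ _)
  map_zero' := by
    have := (RingQuot.mkRingHom_rel (URel.add (K := K) (𝔤 := 𝔤) 0 0)).trans (map_add _ _ _)
    rw [add_zero] at this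
    exact left_eq_add.1 this
  map_add' k l := (RingQuot.mkRingHom_rel (URel.add k l)).trans (map_add _ _ _)

/-- The canonical map `𝔤 → U(𝔤)`. -/
noncomputable def j : 𝔤 →+ U K 𝔤 :=
  AddMonoidHom.mk' (fun a => RingQuot.mkRingHom (URel K 𝔤) (FreeRing.of (.inr a)))
    fun a b => (RingQuot.mkRingHom_rel (URel.add' a b)).trans (map_add _ _ _)

variable {K 𝔤}

theorem j_smul (k : K) (a : 𝔤) : j K 𝔤 (k • a) = ι K 𝔤 k * j K 𝔤 a :=
  (RingQuot.mkRingHom_rel (URel.smul (K := K) k a)).trans (map_mul _ _ _)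

theorem j_mul_ι {i l : ZMod 2} {a : 𝔤} {k : K} (ha : a ∈ gr 𝔤 i) (hk : k ∈ gr K l) :
    j K 𝔤 a * ι K 𝔤 k = ks i l • (ι K 𝔤 k * j K 𝔤 a) := by
  have := RingQuot.mkRingHom_rel (URel.comm (K := K) ha hk)
  rw [map_zsmul, map_mul, map_mul] at this
  exact this

theorem j_br {i l : ZMod 2} {a b : 𝔤} (ha : a ∈ gr 𝔤 i) (hb : b ∈ gr 𝔤 l) :
    j K 𝔤 (LieSuperalgebra.br K a b) =
      j K 𝔤 a * j K 𝔤 b - ks i l • (j K 𝔤 b * j K 𝔤 a) := by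
  have := RingQuot.mkRingHom_rel (URel.br (K := K) ha hb)
  rw [map_sub, map_zsmul, map_mul, map_mul] at this
  exact this

/-- The universal property of `U(𝔤)`. -/
noncomputable def lift {B : Type*} [Ring B] (κ : K →+* B) (γ : 𝔤 →+ B)
    (h1 : ∀ k a, γ (k • a) = κ k * γ a)
    (h2 : ∀ (i l : ZMod 2) (a : 𝔤) (k : K), a ∈ gr 𝔤 i → k ∈ gr K l →
      γ a * κ k = ks i l • (κ k * γ a))
    (h3 : ∀ (i l : ZMod 2) (a b : 𝔤), a ∈ gr 𝔤 i → b ∈ gr 𝔤 l →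
      γ (LieSuperalgebra.br K a b) = γ a * γ b - ks i l • (γ b * γ a)) : U K 𝔤 →+* B :=
  RingQuot.lift ⟨FreeRing.lift (Sum.elim κ γ), by
    intro x y h
    cases h with
    | one => simp
    | add k l => simp
    | mul k l => simp
    | add' a b => simp
    | smul k a => simp [h1]
    | comm ha hk => simp [h2 _ _ _ _ ha hk]
    | br ha hb => simp [h3 _ _ _ _ ha hb]⟩

section
variable {B : Type*} [Ring B] (κ : K →+* B) (γ : 𝔤 →+ B)
    (h1 : ∀ k a, γ (k • a) = κ k * γ a)
    (h2 : ∀ (i l : ZMod 2) (a : 𝔤) (k : K), a ∈ gr 𝔤 i → k ∈ gr K l →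
      γ a * κ k = ks i l • (κ k * γ a))
    (h3 : ∀ (i l : ZMod 2) (a b : 𝔤), a ∈ gr 𝔤 i → b ∈ gr 𝔤 l →
      γ (LieSuperalgebra.br K a b) = γ a * γ b - ks i l • (γ b * γ a))

theorem lift_ι (k : K) : lift κ γ h1 h2 h3 (ι K 𝔤 k) = κ k := by
  unfold lift
  exact (RingQuot.lift_mkRingHom_apply _ _ _).trans (by simp)

theorem lift_j (a : 𝔤) : lift κ γ h1 h2 h3 (j K 𝔤 a) = γ a := by
  unfold lift
  exact (RingQuot.lift_mkRingHom_apply _ _ _).trans (by simp)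
end

theorem induction_ring {P : U K 𝔤 → Prop} (hι : ∀ k, P (ι K 𝔤 k)) (hj : ∀ a, P (j K 𝔤 a))
    (add : ∀ u v, P u → P v → P (u + v)) (mul : ∀ u v, P u → P v → P (u * v)) (u : U K 𝔤) :
    P u := by
  obtain ⟨x, rfl⟩ := RingQuot.mkRingHom_surjective (URel K 𝔤) u
  have hneg : P (-1) := by simpa using hι (-1)
  induction x using FreeRing.induction_on with
  | hn1 => rw [map_neg, map_one]; exact hneg
  | hb b =>
    cases b with
    | inl k => exact hι k
    | inr a => exact hj a
  | ha x y hx hy => rw [map_add]; exact add _ _ hx hy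
  | hm x y hx hy => rw [map_mul]; exact mul _ _ hx hy

/-- Induction on the length of monomials. -/
theorem induction_left {P : U K 𝔤 → Prop} (hι : ∀ k, P (ι K 𝔤 k))
    (add : ∀ u v, P u → P v → P (u + v))
    (hj : ∀ i, ∀ a ∈ gr 𝔤 i, ∀ u, P u → P (j K 𝔤 a * u)) (u : U K 𝔤) : P u := by
  have key : ∀ u w : U K 𝔤, (∀ k, P (ι K 𝔤 k * w)) → ∀ k, P (ι K 𝔤 k * (u * w)) := by
    intro u
    induction u using induction_ring with
    | hι l =>
      intro w hw k
      rw [← mul_assoc, ← map_mul]; exact hw _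
    | add u v hu hv =>
      intro w hw k
      rw [add_mul, mul_add]; exact add _ _ (hu w hw k) (hv w hw k)
    | mul u v hu hv =>
      intro w hw k
      rw [mul_assoc]; exact hu _ (fun k => hv _ hw k) k
    | hj a =>
      intro w hw k
      induction a using homog_induction with
      | add a b ha hb => rw [map_add, add_mul, mul_add]; exact add _ _ ha hb
      | hom i a ha =>
      induction k using homog_induction with
      | add k l hk hl => rw [map_add, add_mul]; exact add _ _ hk hl
      | hom l k hk =>
      have : ι K 𝔤 k * (j K 𝔤 a * w) = j K 𝔤 a * (ι K 𝔤 (ks i l • k) * w) := by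
        rw [map_zsmul, smul_mul_assoc, mul_smul_comm, ← mul_assoc (j K 𝔤 a), j_mul_ι ha hk,
          smul_mul_assoc, smul_smul, ks_mul_self, one_smul, mul_assoc]
      rw [this]
      exact hj i a ha _ (hw _)
  have := key u 1 (fun k => by simpa using hι k) 1
  simpa using this

end U
end Enveloping

section EnvelopingGrading
variable {K 𝔤 : Type*} [Ring K] [Algebra ℚ K] [SuperGraded K] [SuperCommRing K] [AddCommGroup 𝔤]
  [SuperGraded 𝔤] [Module K 𝔤] [LieSuperalgebra K 𝔤]

namespace U

/-- The parity automorphism of `U(𝔤)`, induced by those of `K` and `𝔤`. -/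
noncomputable def parity : U K 𝔤 →+* U K 𝔤 :=
  lift
    ((ι K 𝔤).comp
      { toFun := twist 1, map_zero' := map_zero _, map_add' := map_add _,
        map_one' := twist_one 1, map_mul' := twist_mul 1 })
    ((j K 𝔤).comp (twist 1))
    (fun k a => by simp [twist_smul, j_smul])
    (fun i l a k ha hk => by
      simp only [AddMonoidHom.comp_apply, RingHom.comp_apply, RingHom.coe_mk, MonoidHom.coe_mk,
        OneHom.coe_mk]
      exact j_mul_ι (twist_mem 1 ha) (twist_mem 1 hk))
    (fun i l a b ha hb => by
      simp only [AddMonoidHom.comp_apply]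
      rw [← j_br (twist_mem 1 ha) (twist_mem 1 hb), twist_of_mem _ ha, twist_of_mem _ hb,
        twist_of_mem _ (LieSuperalgebra.br_mem ha hb), map_zsmul, map_zsmul, map_zsmul,
        map_zsmul (LieSuperalgebra.br K), AddMonoidHom.coe_smul, Pi.smul_apply, map_zsmul, smul_smul, ks_add_right, mul_comm])

theorem parity_ι (k : K) : parity (ι K 𝔤 k) = ι K 𝔤 (twist 1 k) := lift_ι ..

theorem parity_j (a : 𝔤) : parity (j K 𝔤 a) = j K 𝔤 (twist 1 a) := lift_j ..

theorem parity_parity (u : U K 𝔤) : parity (parity u) = u := by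
  induction u using induction_ring with
  | hι k => rw [parity_ι, parity_ι, twist_twist]
  | hj a => rw [parity_j, parity_j, twist_twist]
  | add u v hu hv => rw [map_add, map_add, hu, hv]
  | mul u v hu hv => rw [map_mul, map_mul, hu, hv]

variable (K 𝔤) in
theorem half : ι K 𝔤 (algebraMap ℚ K 2⁻¹) + ι K 𝔤 (algebraMap ℚ K 2⁻¹) = 1 := by
  rw [← map_add, ← map_add, show (2⁻¹ + 2⁻¹ : ℚ) = 1 by norm_num, map_one, map_one]

variable (K) in
theorem rat_mem (r : ℚ) : algebraMap ℚ K r ∈ gr K 0 := by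
  have h1 : comp 1 (algebraMap ℚ K r) = 0 := by
    have hlin : ∀ (c : ℚ) (x : K), comp 1 (c • x) = c • comp 1 x := fun c x =>
      map_rat_smul (comp 1 : K →+ K) c x
    rw [Algebra.algebraMap_eq_smul_one, hlin, comp_of_mem SuperCommRing.one_mem]
    simp
  have := comp_add_comp (algebraMap ℚ K r)
  rw [h1, add_zero] at this
  rw [← this]; exact comp_mem _ _

/-- The even part of `U(𝔤)` is the `1`-eigenspace of the parity automorphism, the odd part its
`-1`-eigenspace. -/
noncomputable instance : SuperGraded (U K 𝔤) where
  gr i :=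
    { carrier := {u | parity u = ks 1 i • u}
      add_mem' := fun {u v} hu hv => by
        simp only [Set.mem_ofPred_eq] at *
        rw [map_add, hu, hv, smul_add]
      zero_mem' := by simp
      smul_mem' := fun c u hu => by
        simp only [Set.mem_ofPred_eq] at *
        rw [map_zsmul, hu, smul_comm] }
  isCompl := by
    have hp : parity (ι K 𝔤 (algebraMap ℚ K 2⁻¹)) = ι K 𝔤 (algebraMap ℚ K 2⁻¹) := by
      rw [parity_ι, twist_of_mem _ (rat_mem K _), ks_zero_right, one_smul]
    have e0 : ks 1 0 = 1 := by decide
    have e1 : ks 1 1 = -1 := by decide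
    refine isCompl_of (fun u => ⟨ι K 𝔤 (algebraMap ℚ K 2⁻¹) * (u + parity u), ?_,
      ι K 𝔤 (algebraMap ℚ K 2⁻¹) * (u - parity u), ?_, ?_⟩) ?_
    · change parity _ = _
      rw [map_mul, map_add, parity_parity, hp, e0, one_smul, add_comm u]
    · change parity _ = _
      rw [map_mul, map_sub, parity_parity, hp, e1, neg_smul, one_smul, ← mul_neg, neg_sub]
    · rw [← mul_add, add_add_sub_cancel, mul_add, ← add_mul, half, one_mul]
    · intro u hu hv
      change parity _ = _ at hu
      change parity _ = _ at hv
      rw [e0, one_smul] at hu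
      rw [e1, neg_smul, one_smul, hu] at hv
      have : u = -u := hv
      rw [← one_mul u, ← half K 𝔤, add_mul, ← mul_add]
      nth_rewrite 2 [this]
      rw [add_neg_cancel, mul_zero]

theorem mem_gr {i : ZMod 2} {u : U K 𝔤} : u ∈ gr (U K 𝔤) i ↔ parity u = ks 1 i • u := Iff.rfl

theorem parity_eq_twist (u : U K 𝔤) : parity u = twist 1 u := by
  induction u using homog_induction with
  | hom i u hu => rw [twist_of_mem _ hu]; exact hu
  | add u v hu hv => rw [map_add, map_add, hu, hv]

theorem ι_mem {i : ZMod 2} {k : K} (hk : k ∈ gr K i) : ι K 𝔤 k ∈ gr (U K 𝔤) i := by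
  rw [mem_gr, parity_ι, twist_of_mem _ hk, map_zsmul]

theorem j_mem {i : ZMod 2} {a : 𝔤} (ha : a ∈ gr 𝔤 i) : j K 𝔤 a ∈ gr (U K 𝔤) i := by
  rw [mem_gr, parity_j, twist_of_mem _ ha, map_zsmul]

instance : SetLike.GradedMonoid (gr (U K 𝔤)) where
  one_mem := by rw [← map_one (ι K 𝔤)]; exact ι_mem SuperCommRing.one_mem
  mul_mem i l u v hu hv := by
    rw [mem_gr] at *
    rw [map_mul, hu, hv, smul_mul_smul_comm, ks_add_right]

theorem mul_mem {i l : ZMod 2} {u v : U K 𝔤} (hu : u ∈ gr (U K 𝔤) i) (hv : v ∈ gr (U K 𝔤) l) :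
    u * v ∈ gr (U K 𝔤) (i + l) := SetLike.mul_mem_graded hu hv

theorem twist_mul (i : ZMod 2) (u v : U K 𝔤) : twist i (u * v) = twist i u * twist i v := by
  obtain rfl | rfl : i = 0 ∨ i = 1 := by revert i; decide
  · simp only [twist_zero]
  · simp only [← parity_eq_twist, map_mul]

/-- Elements of `K` supercommute with `U(𝔤)`. -/
theorem mul_ι {i l : ZMod 2} {u : U K 𝔤} {k : K} (hu : u ∈ gr (U K 𝔤) i) (hk : k ∈ gr K l) :
    u * ι K 𝔤 k = ks i l • (ι K 𝔤 k * u) := by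
  have key : ∀ u : U K 𝔤, u * ι K 𝔤 k = ι K 𝔤 k * twist l u := by
    intro u
    induction u using induction_left with
    | hι m =>
      have : twist l (ι K 𝔤 m) = ι K 𝔤 (twist l m) := by
        induction m using homog_induction with
        | hom n m hm => rw [twist_of_mem _ hm, twist_of_mem _ (ι_mem hm), map_zsmul]
        | add m n hm hn => simp only [map_add, hm, hn]
      rw [this, ← map_mul, ← map_mul]
      congr 1
      rw [← rsmul_eq_mul, rsmul_twist _ hk, smul_eq_mul]
    | add u v hu hv => rw [add_mul, hu, hv, map_add, mul_add]
    | hj n a ha u hu =>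
      rw [mul_assoc, hu, ← mul_assoc, j_mul_ι ha hk, twist_mul, twist_of_mem _ (j_mem ha),
        smul_mul_assoc, smul_mul_assoc, mul_smul_comm, mul_assoc, ks_comm]
  rw [key, twist_of_mem _ hu, mul_smul_comm, ks_comm]

end U
end EnvelopingGrading


section Coproduct
variable (K 𝔤 : Type*) [Ring K] [Algebra ℚ K] [SuperGraded K] [SuperCommRing K] [AddCommGroup 𝔤]
  [SuperGraded 𝔤] [Module K 𝔤] [LieSuperalgebra K 𝔤]

noncomputable instance : GradedAlgebra (gr (U K 𝔤)) where

/-- `U(𝔤) ⊗_ℤ U(𝔤)` with the product `(a ⊗ b) (c ⊗ d) = (-1)^(p(b) p(c)) a c ⊗ b d`. -/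
abbrev UZ : Type _ := GradedTensorProduct ℤ (gr (U K 𝔤)) (gr (U K 𝔤))

variable {K 𝔤} in
/-- The tensor `u ⊗ v`. -/
noncomputable def UZ.tmul : U K 𝔤 →+ U K 𝔤 →+ UZ K 𝔤 :=
  AddMonoidHom.mk' (fun u => AddMonoidHom.mk' (fun v => GradedTensorProduct.tmul ℤ u v)
    fun v w => congrArg (GradedTensorProduct.of ℤ _ _) (TensorProduct.tmul_add u v w))
    fun u v => AddMonoidHom.ext fun w =>
      congrArg (GradedTensorProduct.of ℤ _ _) (TensorProduct.add_tmul u v w)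

/-- The two-sided ideal generated by the elements `k ⊗ 1 - 1 ⊗ k` for `k ∈ K`. It is the additive
group generated by the elements `u k ⊗ v - u ⊗ k v`. -/
noncomputable def UZ.balance : TwoSidedIdeal (UZ K 𝔤) :=
  TwoSidedIdeal.span (Set.range fun k : K =>
    UZ.tmul (U.ι K 𝔤 k) 1 - UZ.tmul 1 (U.ι K 𝔤 k))

/-- The superalgebra `U(𝔤) ⊗_K U(𝔤)`. -/
abbrev UU : Type _ := UZ K 𝔤 ⧸ (UZ.balance K 𝔤).asIdeal

variable {K 𝔤}

theorem UZ.tmul_mul_tmul {i l : ZMod 2} {a b c d : U K 𝔤} (hb : b ∈ gr (U K 𝔤) i)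
    (hc : c ∈ gr (U K 𝔤) l) :
    UZ.tmul a b * UZ.tmul c d = ks i l • UZ.tmul (a * c) (b * d) := by
  have := GradedTensorProduct.tmul_coe_mul_coe_tmul (R := ℤ) (𝒜 := gr (U K 𝔤))
    (ℬ := gr (U K 𝔤)) a ⟨b, hb⟩ ⟨c, hc⟩ d
  rw [Units.smul_def, ks_eq] at this
  exact this

theorem UZ.induction {P : UZ K 𝔤 → Prop} (add : ∀ x y, P x → P y → P (x + y))
    (tmul : ∀ i l, ∀ u ∈ gr (U K 𝔤) i, ∀ v ∈ gr (U K 𝔤) l, P (UZ.tmul u v)) (x : UZ K 𝔤) :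
    P x := by
  have h0 : P 0 := by
    have := tmul 0 0 0 (Submodule.zero_mem _) 0 (Submodule.zero_mem _)
    simpa using this
  have key : ∀ y : TensorProduct ℤ (U K 𝔤) (U K 𝔤), P (GradedTensorProduct.of ℤ _ _ y) := by
    intro y
    induction y using TensorProduct.induction_on with
    | zero => simpa using h0
    | add x y hx hy => rw [map_add]; exact add _ _ hx hy
    | tmul u v =>
      change P (UZ.tmul u v)
      induction u using homog_induction with
      | add a b ha hb => rw [map_add, AddMonoidHom.add_apply]; exact add _ _ ha hb
      | hom i u hu =>
      induction v using homog_induction with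
      | add a b ha hb => rw [map_add]; exact add _ _ ha hb
      | hom l v hv => exact tmul i l u hu v hv
  simpa using key ((GradedTensorProduct.of ℤ _ _).symm x)

/-- The class in `U(𝔤) ⊗_K U(𝔤)`. -/
noncomputable abbrev UU.mk : UZ K 𝔤 →+* UU K 𝔤 := Ideal.Quotient.mk _

theorem UU.mk_balance (k : K) :
    UU.mk (UZ.tmul (U.ι K 𝔤 k) 1) = UU.mk (UZ.tmul 1 (U.ι K 𝔤 k)) := by
  rw [Ideal.Quotient.mk_eq_mk_iff_sub_mem, TwoSidedIdeal.mem_asIdeal]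
  exact TwoSidedIdeal.subset_span ⟨k, rfl⟩

theorem UZ.one_def : (1 : UZ K 𝔤) = UZ.tmul 1 1 := rfl

theorem U.one_mem : (1 : U K 𝔤) ∈ gr (U K 𝔤) 0 := SetLike.one_mem_graded _

variable (K 𝔤) in
/-- The map `a ↦ j(a) ⊗ 1 + 1 ⊗ j(a)`. -/
noncomputable def prim : 𝔤 →+ UZ K 𝔤 :=
  AddMonoidHom.mk' (fun a => UZ.tmul (U.j K 𝔤 a) 1 + UZ.tmul 1 (U.j K 𝔤 a)) fun a b => by
    simp only [map_add, AddMonoidHom.add_apply]; abel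

theorem prim_apply (a : 𝔤) : prim K 𝔤 a = UZ.tmul (U.j K 𝔤 a) 1 + UZ.tmul 1 (U.j K 𝔤 a) := rfl

variable (K 𝔤) in
/-- The coproduct of `U(𝔤)`: the morphism of superalgebras over `K` with
`Δ(j(a)) = j(a) ⊗ 1 + 1 ⊗ j(a)`. -/
noncomputable def coprod : U K 𝔤 →+* UU K 𝔤 :=
  U.lift
    (UU.mk.comp ((GradedTensorProduct.includeLeftRingHom (R := ℤ) (gr (U K 𝔤)) (gr (U K 𝔤))).comp
      (U.ι K 𝔤)))
    ((UU.mk : UZ K 𝔤 →+* UU K 𝔤).toAddMonoidHom.comp (prim K 𝔤))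
    (fun k a => by
      change UU.mk (prim K 𝔤 (k • a)) = UU.mk (UZ.tmul (U.ι K 𝔤 k) 1) * UU.mk (prim K 𝔤 a)
      have h1 : UZ.tmul 1 (U.ι K 𝔤 k * U.j K 𝔤 a)
          = UZ.tmul 1 (U.ι K 𝔤 k) * UZ.tmul 1 (U.j K 𝔤 a) := by
        induction k using homog_induction with
        | add a b ha hb => simp only [map_add, add_mul, ha, hb]
        | hom i k hk =>
          rw [UZ.tmul_mul_tmul (U.ι_mem hk) U.one_mem, ks_zero_right, one_smul, one_mul]
      have h2 : UZ.tmul (U.ι K 𝔤 k * U.j K 𝔤 a) 1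
          = UZ.tmul (U.ι K 𝔤 k) 1 * UZ.tmul (U.j K 𝔤 a) 1 := by
        clear h1
        induction a using homog_induction with
        | add a b ha hb => simp only [map_add, mul_add, AddMonoidHom.add_apply, ha, hb]
        | hom i a ha =>
          rw [UZ.tmul_mul_tmul U.one_mem (U.j_mem ha), ks_zero_left, one_smul, one_mul]
      rw [prim_apply, prim_apply, map_add, map_add, mul_add, U.j_smul, h1, map_mul UU.mk,
        ← UU.mk_balance, h2, map_mul UU.mk])
    (fun i l a k ha hk => by
      change UU.mk (prim K 𝔤 a) * UU.mk (UZ.tmul (U.ι K 𝔤 k) 1) =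
        ks i l • (UU.mk (UZ.tmul (U.ι K 𝔤 k) 1) * UU.mk (prim K 𝔤 a))
      rw [← map_mul, ← map_mul, ← map_zsmul, prim_apply, add_mul, mul_add,
        UZ.tmul_mul_tmul U.one_mem (U.ι_mem hk), UZ.tmul_mul_tmul (U.j_mem ha) (U.ι_mem hk),
        UZ.tmul_mul_tmul U.one_mem (U.j_mem ha), UZ.tmul_mul_tmul U.one_mem U.one_mem,
        U.j_mul_ι ha hk]
      simp only [ks_zero_left, one_smul, one_mul, mul_one, map_zsmul, AddMonoidHom.smul_apply,
        smul_add])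
    (fun i l a b ha hb => by
      change UU.mk (prim K 𝔤 _) = UU.mk (prim K 𝔤 a) * UU.mk (prim K 𝔤 b) -
        ks i l • (UU.mk (prim K 𝔤 b) * UU.mk (prim K 𝔤 a))
      rw [← map_mul UU.mk, ← map_mul UU.mk, ← map_zsmul, ← map_sub]
      refine congrArg UU.mk ?_
      simp only [prim_apply, add_mul, mul_add, UZ.tmul_mul_tmul U.one_mem (U.j_mem hb),
        UZ.tmul_mul_tmul (U.j_mem ha) (U.j_mem hb), UZ.tmul_mul_tmul U.one_mem (U.j_mem ha),
        UZ.tmul_mul_tmul (U.j_mem hb) (U.j_mem ha), UZ.tmul_mul_tmul U.one_mem U.one_mem,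
        UZ.tmul_mul_tmul (U.j_mem ha) U.one_mem, UZ.tmul_mul_tmul (U.j_mem hb) U.one_mem,
        U.j_br ha hb, ks_zero_left, ks_zero_right, one_smul, one_mul, mul_one, map_sub, map_zsmul,
        AddMonoidHom.sub_apply, AddMonoidHom.smul_apply, smul_add, smul_smul, ks_comm l i,
        ks_mul_self]
      abel)

theorem coprod_ι (k : K) : coprod K 𝔤 (U.ι K 𝔤 k) = UU.mk (UZ.tmul (U.ι K 𝔤 k) 1) :=
  U.lift_ι ..

theorem coprod_j (a : 𝔤) : coprod K 𝔤 (U.j K 𝔤 a) =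
    UU.mk (UZ.tmul (U.j K 𝔤 a) 1 + UZ.tmul 1 (U.j K 𝔤 a)) :=
  U.lift_j ..

end Coproduct


section Functions
variable (K 𝔤 N : Type*) [Ring K] [Algebra ℚ K] [SuperGraded K] [SuperCommRing K] [AddCommGroup 𝔤]
  [SuperGraded 𝔤] [Module K 𝔤] [LieSuperalgebra K 𝔤] [AddCommGroup N] [SuperGraded N]
  [Module K N] [SuperModule K N]

/-- The formal functions `F(G, N) = Hom_K(U(𝔤), N)`, where `Hom_K` consists of all right `K`-linear
maps. A map that is homogeneous of parity `p` is right `K`-linear if and only if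
`f (k u) = (-1)^(p p(k)) k (f u)`. -/
def GFun : AddSubgroup (U K 𝔤 →+ N) where
  carrier := {f | ∀ u k, f (u * U.ι K 𝔤 k) = rsmul (f u) k}
  zero_mem' u k := by simp [rsmul]
  add_mem' {f g} hf hg u k := by
    simp only [AddMonoidHom.add_apply, hf u k, hg u k, add_rsmul]
  neg_mem' {f} hf u k := by simp only [AddMonoidHom.neg_apply, hf u k, neg_rsmul]

namespace GFun
variable {K 𝔤 N}

@[ext] theorem ext' {f g : GFun K 𝔤 N} (h : ∀ u, f.1 u = g.1 u) : f = g :=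
  Subtype.ext (AddMonoidHom.ext h)

theorem apply_mul_ι (f : GFun K 𝔤 N) (u : U K 𝔤) (k : K) :
    f.1 (u * U.ι K 𝔤 k) = rsmul (f.1 u) k := f.2 u k

theorem apply_ι (f : GFun K 𝔤 N) (k : K) : f.1 (U.ι K 𝔤 k) = rsmul (f.1 1) k := by
  rw [← apply_mul_ι, one_mul]

variable (K 𝔤 N) in
/-- The functions that are homogeneous of parity `i`. -/
def gr (i : ZMod 2) : AddSubgroup (GFun K 𝔤 N) where
  carrier := {f | ∀ l, ∀ u ∈ SuperLie.gr (U K 𝔤) l, f.1 u ∈ SuperLie.gr N (i + l)}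
  zero_mem' _ _ _ := Submodule.zero_mem _
  add_mem' hf hg l u hu := Submodule.add_mem _ (hf l u hu) (hg l u hu)
  neg_mem' hf l u hu := Submodule.neg_mem _ (hf l u hu)

theorem twist_ι (i : ZMod 2) (k : K) : twist i (U.ι K 𝔤 k) = U.ι K 𝔤 (twist i k) := by
  induction k using homog_induction with
  | hom n m hm => rw [twist_of_mem _ hm, twist_of_mem _ (U.ι_mem hm), map_zsmul]
  | add m n hm hn => simp only [map_add, hm, hn]

theorem twist_j (i : ZMod 2) (a : 𝔤) : twist i (U.j K 𝔤 a) = U.j K 𝔤 (twist i a) := by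
  induction a using homog_induction with
  | hom n m hm => rw [twist_of_mem _ hm, twist_of_mem _ (U.j_mem hm), map_zsmul]
  | add m n hm hn => simp only [map_add, hm, hn]

/-- `f ↦ (-1)^(i p(f)) f`. -/
noncomputable def tw (i : ZMod 2) : GFun K 𝔤 N →+ GFun K 𝔤 N :=
  AddMonoidHom.mk' (fun f => ⟨(twist i).comp (f.1.comp (twist i)), fun u k => by
    simp only [AddMonoidHom.comp_apply, U.twist_mul, twist_ι, apply_mul_ι, twist_rsmul,
      twist_twist]⟩) fun f g => by ext u; simp

theorem tw_apply (i : ZMod 2) (f : GFun K 𝔤 N) (u : U K 𝔤) :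
    (tw i f).1 u = twist i (f.1 (twist i u)) := rfl

theorem tw_of_mem {i l : ZMod 2} {f : GFun K 𝔤 N} (hf : f ∈ gr K 𝔤 N l) :
    tw i f = ks i l • f := by
  ext u
  induction u using homog_induction with
  | add u v hu hv => simp only [map_add, hu, hv]
  | hom n u hu =>
    rw [tw_apply, twist_of_mem _ hu, map_zsmul, map_zsmul, twist_of_mem _ (hf n u hu), smul_smul,
      ks_add_right, mul_left_comm, ks_mul_self, mul_one]
    rfl

theorem tw_tw (i l : ZMod 2) (f : GFun K 𝔤 N) : tw i (tw l f) = tw (i + l) f := by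
  ext u
  simp only [tw_apply]
  rw [twist_add, add_comm i l, twist_add]

theorem tw_zero (f : GFun K 𝔤 N) : tw 0 f = f := by
  ext u; simp only [tw_apply, twist_zero]

/-- The map `f ↦ (u ↦ f (j(a) u))`. -/
noncomputable def L (a : 𝔤) : GFun K 𝔤 N →+ GFun K 𝔤 N :=
  AddMonoidHom.mk' (fun f => ⟨f.1.comp (AddMonoidHom.mulLeft (U.j K 𝔤 a)), fun u k => by
    change f.1 (U.j K 𝔤 a * (u * U.ι K 𝔤 k)) = rsmul (f.1 (U.j K 𝔤 a * u)) k
    rw [← mul_assoc, apply_mul_ι]⟩)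
    fun f g => by ext u; simp

theorem L_apply (a : 𝔤) (f : GFun K 𝔤 N) (u : U K 𝔤) : (L a f).1 u = f.1 (U.j K 𝔤 a * u) := rfl

theorem L_add (a b : 𝔤) (f : GFun K 𝔤 N) : L (a + b) f = L a f + L b f := by
  ext u
  change f.1 (U.j K 𝔤 (a + b) * u) = f.1 (U.j K 𝔤 a * u) + f.1 (U.j K 𝔤 b * u)
  rw [map_add, add_mul, map_add]

theorem L_tw {i : ZMod 2} {a : 𝔤} (ha : a ∈ SuperLie.gr 𝔤 i) (l : ZMod 2) (f : GFun K 𝔤 N) :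
    L a (tw l f) = ks l i • tw l (L a f) := by
  ext u
  change twist l (f.1 (twist l (U.j K 𝔤 a * u))) = ks l i • twist l (f.1 (U.j K 𝔤 a * twist l u))
  rw [U.twist_mul, twist_of_mem _ (U.j_mem ha), smul_mul_assoc, map_zsmul, map_zsmul]

/-- The map `f ⊗ g`, where
`(f ⊗ g) (u ⊗ v) = (-1)^(p(g) p(u)) (f u) (g v)`. -/
noncomputable def pairZ (f : GFun K 𝔤 K) (g : GFun K 𝔤 N) : UZ K 𝔤 →+ N :=
  (TensorProduct.liftAddHom
    (AddMonoidHom.mk' (fun u : U K 𝔤 => AddMonoidHom.mk' (fun v : U K 𝔤 =>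
        ∑ i, f.1 (comp i u) • (tw i g).1 v)
      fun v w => by simp [smul_add, Finset.sum_add_distrib])
      fun u v => by ext w; simp [add_smul, Finset.sum_add_distrib])
    (fun r u v => by
      change ∑ i, f.1 (comp i (r • u)) • (tw i g).1 v = ∑ i, f.1 (comp i u) • (tw i g).1 (r • v)
      simp only [map_zsmul, smul_assoc, smul_comm r])).comp
  (GradedTensorProduct.of ℤ (SuperLie.gr (U K 𝔤)) (SuperLie.gr (U K 𝔤))).symm.toAddEquiv.toAddMonoidHom

theorem pairZ_tmul (f : GFun K 𝔤 K) (g : GFun K 𝔤 N) {i : ZMod 2} {u : U K 𝔤}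
    (hu : u ∈ SuperLie.gr (U K 𝔤) i) (v : U K 𝔤) :
    pairZ f g (UZ.tmul u v) = f.1 u • (tw i g).1 v := by
  have h1 : pairZ f g (UZ.tmul u v) = ∑ i, f.1 (comp i u) • (tw i g).1 v := rfl
  have : ∀ l, f.1 (comp l u) • (tw l g).1 v = if i = l then f.1 u • (tw i g).1 v else 0 := by
    intro l
    rw [comp_of_mem hu]
    split_ifs with h
    · rw [h]
    · simp
  rw [h1]
  simp [this]

theorem pairZ_balance (f : GFun K 𝔤 K) (g : GFun K 𝔤 N) {x : UZ K 𝔤}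
    (hx : x ∈ (UZ.balance K 𝔤).asIdeal) : pairZ f g x = 0 := by
  rw [TwoSidedIdeal.mem_asIdeal, UZ.balance,
    TwoSidedIdeal.mem_span_iff_mem_addSubgroup_closure] at hx
  induction hx using AddSubgroup.closure_induction with
  | zero => simp
  | add x y _ _ hx hy => rw [map_add, hx, hy, add_zero]
  | neg x _ hx => rw [map_neg, hx, neg_zero]
  | mem x hx =>
    obtain ⟨_, ⟨x, -, _, ⟨k, rfl⟩, rfl⟩, y, -, rfl⟩ := hx
    simp only [mul_sub, sub_mul, map_sub, sub_eq_zero]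
    induction k using homog_induction with
    | add k k' hk hk' => simp only [map_add, mul_add, add_mul, AddMonoidHom.add_apply, hk, hk']
    | hom p k hk =>
    induction x using UZ.induction with
    | add x x' hx hx' => simp only [map_add, add_mul, hx, hx']
    | tmul i l a ha b hb =>
    induction y using UZ.induction with
    | add y y' hy hy' => simp only [map_add, mul_add, hy, hy']
    | tmul m n c hc d hd =>
    have h1 : U.ι K 𝔤 k * c = ks p m • (c * U.ι K 𝔤 k) := by
      rw [U.mul_ι hc hk, smul_smul, ks_comm p m, ks_mul_self, one_smul]
    have h2 : U.ι K 𝔤 k * d = ks p n • (d * U.ι K 𝔤 k) := by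
      rw [U.mul_ι hd hk, smul_smul, ks_comm p n, ks_mul_self, one_smul]
    have h3 : (tw (i + p + m) g).1 (b * d) = ks p (l + n) • twist p ((tw (i + m) g).1 (b * d)) := by
      rw [add_right_comm, add_comm, ← tw_tw, tw_apply, twist_of_mem _ (U.mul_mem hb hd), map_zsmul,
        map_zsmul]
    have h4 : ∀ l p m n : ZMod 2,
        ks l p * (ks l m * (ks p m * ks p (l + n))) = ks (l + p) m * ks p n := by decide
    rw [UZ.tmul_mul_tmul hb (U.ι_mem hk), UZ.tmul_mul_tmul hb U.one_mem, smul_mul_assoc,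
      smul_mul_assoc, mul_one, mul_one, UZ.tmul_mul_tmul hb hc,
      UZ.tmul_mul_tmul (U.mul_mem hb (U.ι_mem hk)) hc, ks_zero_right, one_smul, map_zsmul,
      map_zsmul, map_zsmul, pairZ_tmul _ _ (U.mul_mem (U.mul_mem ha (U.ι_mem hk)) hc),
      pairZ_tmul _ _ (U.mul_mem ha hc), mul_assoc a, h1, mul_assoc b, h2, mul_smul_comm,
      mul_smul_comm, map_zsmul, map_zsmul, ← mul_assoc, ← mul_assoc, apply_mul_ι, apply_mul_ι,
      rsmul_eq_mul, h3, rsmul_twist _ hk, smul_assoc, smul_comm (_ * k), smul_smul, smul_smul,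
      smul_smul, smul_comm (f.1 (a * c)), smul_smul, smul_smul]
    rw [← h4 l p m n]
    simp only [mul_assoc]

/-- The map `f ⊗ g` on `U(𝔤) ⊗_K U(𝔤)`. -/
noncomputable def pair (f : GFun K 𝔤 K) (g : GFun K 𝔤 N) : UU K 𝔤 →+ N :=
  QuotientAddGroup.lift _ (pairZ f g) fun _ hx => pairZ_balance f g hx

theorem pair_mk (f : GFun K 𝔤 K) (g : GFun K 𝔤 N) (x : UZ K 𝔤) :
    pair f g (UU.mk x) = pairZ f g x := rfl

theorem UU.induction {P : UU K 𝔤 → Prop} (add : ∀ x y, P x → P y → P (x + y))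
    (tmul : ∀ i l, ∀ u ∈ SuperLie.gr (U K 𝔤) i, ∀ v ∈ SuperLie.gr (U K 𝔤) l,
      P (UU.mk (UZ.tmul u v))) (x : UU K 𝔤) : P x := by
  obtain ⟨x, rfl⟩ := Ideal.Quotient.mk_surjective x
  induction x using UZ.induction with
  | add x y hx hy => rw [map_add]; exact add _ _ hx hy
  | tmul i l u hu v hv => exact tmul i l u hu v hv

/-- The product `f g` of a scalar function `f` and an `N`-valued function `g`:
`(f g)(u) = ∑ ± f(uᵢ) g(uᵢ')` if `Δ(u) = ∑ uᵢ ⊗ uᵢ'`. -/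
noncomputable def conv (f : GFun K 𝔤 K) (g : GFun K 𝔤 N) : GFun K 𝔤 N :=
  ⟨(pair f g).comp (coprod K 𝔤).toAddMonoidHom, fun u k => by
    change pair f g (coprod K 𝔤 (u * U.ι K 𝔤 k)) = rsmul (pair f g (coprod K 𝔤 u)) k
    rw [map_mul, coprod_ι, UU.mk_balance]
    induction coprod K 𝔤 u using UU.induction with
    | add x y hx hy => rw [add_mul, map_add, map_add, hx, hy, add_rsmul]
    | tmul i l u hu v hv =>
      induction k using homog_induction with
      | add a b ha hb => simp only [map_add, mul_add, ha, hb, rsmul_add]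
      | hom n k hk =>
      rw [← map_mul, pair_mk, pair_mk, UZ.tmul_mul_tmul hv U.one_mem, ks_zero_right, one_smul,
        mul_one, pairZ_tmul _ _ hu, pairZ_tmul _ _ hu, apply_mul_ι, smul_rsmul]⟩

theorem conv_apply (f : GFun K 𝔤 K) (g : GFun K 𝔤 N) (u : U K 𝔤) :
    (conv f g).1 u = pair f g (coprod K 𝔤 u) := rfl

theorem conv_one (f : GFun K 𝔤 K) (g : GFun K 𝔤 N) : (conv f g).1 1 = f.1 1 • g.1 1 := by
  rw [conv_apply, map_one]
  change pairZ f g (UZ.tmul 1 1) = _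
  rw [pairZ_tmul _ _ U.one_mem, tw_zero]

theorem conv_j_mul (f : GFun K 𝔤 K) (g : GFun K 𝔤 N) {i : ZMod 2} {a : 𝔤}
    (ha : a ∈ SuperLie.gr 𝔤 i) (u : U K 𝔤) :
    (conv f g).1 (U.j K 𝔤 a * u) = (conv (L a f) (tw i g)).1 u + (conv f (L a g)).1 u := by
  simp only [conv_apply]
  rw [map_mul, coprod_j]
  induction coprod K 𝔤 u using UU.induction with
  | add x y hx hy => rw [mul_add, (pair f g).map_add, hx, hy, map_add, map_add]; abel
  | tmul l n u hu v hv =>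
    rw [← map_mul, pair_mk, pair_mk, pair_mk, add_mul, UZ.tmul_mul_tmul U.one_mem hu,
      UZ.tmul_mul_tmul (U.j_mem ha) hu, ks_zero_left, one_smul, one_mul, one_mul, map_add,
      map_zsmul, pairZ_tmul _ _ (U.mul_mem (U.j_mem ha) hu), pairZ_tmul _ _ hu,
      pairZ_tmul _ _ hu, pairZ_tmul _ _ hu, tw_tw, ← L_apply a (tw l g), L_tw ha, add_comm l i,
      ks_comm l i]
    congr 1
    change _ • _ • (ks i l • (tw l (L a g)).1 v) = _
    rw [smul_comm (f.1 u), smul_smul, ks_mul_self, one_smul]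

end GFun
end Functions


section FunctionRing
variable {K 𝔤 N : Type*} [Ring K] [Algebra ℚ K] [SuperGraded K] [SuperCommRing K] [AddCommGroup 𝔤]
  [SuperGraded 𝔤] [Module K 𝔤] [LieSuperalgebra K 𝔤] [AddCommGroup N] [SuperGraded N]
  [Module K N] [SuperModule K N]

namespace GFun

theorem conv_add (f : GFun K 𝔤 K) (g g' : GFun K 𝔤 N) :
    conv f (g + g') = conv f g + conv f g' := by
  ext u
  change pair f (g + g') _ = pair f g _ + pair f g' _
  induction coprod K 𝔤 u using UU.induction with
  | add x y hx hy => simp only [map_add, hx, hy]; abel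
  | tmul i l u hu v hv =>
    simp only [pair_mk, pairZ_tmul _ _ hu, map_add, AddSubgroup.coe_add, AddMonoidHom.add_apply,
      smul_add]

theorem add_conv (f f' : GFun K 𝔤 K) (g : GFun K 𝔤 N) :
    conv (f + f') g = conv f g + conv f' g := by
  ext u
  change pair (f + f') g _ = pair f g _ + pair f' g _
  induction coprod K 𝔤 u using UU.induction with
  | add x y hx hy => simp only [map_add, hx, hy]; abel
  | tmul i l u hu v hv =>
    simp only [pair_mk, pairZ_tmul _ _ hu, AddSubgroup.coe_add, AddMonoidHom.add_apply, add_smul]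

/-- The product as a biadditive map. -/
noncomputable def convHom : GFun K 𝔤 K →+ GFun K 𝔤 N →+ GFun K 𝔤 N :=
  AddMonoidHom.mk' (fun f => AddMonoidHom.mk' (conv f) (conv_add f))
    fun f f' => AddMonoidHom.ext fun g => add_conv f f' g

theorem conv_zsmul (n : ℤ) (f : GFun K 𝔤 K) (g : GFun K 𝔤 N) :
    conv f (n • g) = n • conv f g := by
  have := map_zsmul (convHom (N := N) f) n g
  exact this

theorem zsmul_conv (n : ℤ) (f : GFun K 𝔤 K) (g : GFun K 𝔤 N) :
    conv (n • f) g = n • conv f g := by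
  have := map_zsmul ((convHom (K := K) (𝔤 := 𝔤) (N := N)).flip g) n f
  exact this

theorem zero_conv (g : GFun K 𝔤 N) : conv 0 g = 0 := by
  have := map_zero ((convHom (N := N)).flip g)
  exact this

theorem conv_zero (f : GFun K 𝔤 K) : conv f (0 : GFun K 𝔤 N) = 0 := by
  have := map_zero (convHom (N := N) f)
  exact this

theorem L_conv {i : ZMod 2} {a : 𝔤} (ha : a ∈ SuperLie.gr 𝔤 i) (f : GFun K 𝔤 K)
    (g : GFun K 𝔤 N) : L a (conv f g) = conv (L a f) (tw i g) + conv f (L a g) := by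
  ext u; exact conv_j_mul f g ha u

theorem tw_conv (i : ZMod 2) (f : GFun K 𝔤 K) (g : GFun K 𝔤 N) :
    tw i (conv f g) = conv (tw i f) (tw i g) := by
  ext u
  induction u using U.induction_left generalizing f g with
  | hι k =>
    rw [apply_ι, apply_ι, conv_one, tw_apply, tw_apply, tw_apply,
      twist_of_mem _ U.one_mem, ks_zero_right, one_smul, conv_one, twist_smul]
  | add u v hu hv => rw [map_add, map_add, hu, hv]
  | hj n a ha u hu =>
    rw [← L_apply, ← L_apply, L_tw ha, L_conv ha, L_conv ha, L_tw ha, L_tw ha, conv_zsmul,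
      zsmul_conv, ← smul_add, map_add]
    simp only [AddSubgroup.coe_zsmul, AddMonoidHom.smul_apply]
    congr 1
    simp only [AddSubgroup.coe_add, AddMonoidHom.add_apply]
    rw [hu, hu, tw_tw, tw_tw, add_comm i n]

theorem conv_assoc (f g : GFun K 𝔤 K) (e : GFun K 𝔤 N) :
    conv (conv f g) e = conv f (conv g e) := by
  ext u
  induction u using U.induction_left generalizing f g e with
  | hι k => rw [apply_ι, apply_ι, conv_one, conv_one, conv_one, conv_one, smul_smul, smul_eq_mul]
  | add u v hu hv => rw [map_add, map_add, hu, hv]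
  | hj n a ha u hu =>
    rw [← L_apply, ← L_apply, L_conv ha, L_conv ha, L_conv ha, L_conv ha, add_conv, conv_add,
      tw_conv]
    simp only [AddSubgroup.coe_add, AddMonoidHom.add_apply]
    rw [hu, hu, hu, add_assoc]

end GFun

variable (K 𝔤) in
/-- The counit of `U(𝔤)`. -/
noncomputable def counit : U K 𝔤 →+* K :=
  U.lift (RingHom.id K) 0 (by simp) (by simp) (by simp)

theorem counit_ι (k : K) : counit K 𝔤 (U.ι K 𝔤 k) = k := U.lift_ι ..

theorem counit_j (a : 𝔤) : counit K 𝔤 (U.j K 𝔤 a) = 0 := U.lift_j ..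

namespace GFun

variable (𝔤) in
/-- The constant function with value `k`. -/
noncomputable def const (k : K) : GFun K 𝔤 K :=
  ⟨(AddMonoidHom.mulLeft k).comp (counit K 𝔤).toAddMonoidHom, fun u l => by
    change k * counit K 𝔤 (u * U.ι K 𝔤 l) = rsmul (k * counit K 𝔤 u) l
    rw [map_mul, counit_ι, rsmul_eq_mul, mul_assoc]⟩

theorem const_apply (k : K) (u : U K 𝔤) : (const 𝔤 k).1 u = k * counit K 𝔤 u := rfl

theorem L_const (a : 𝔤) (k : K) : L a (const 𝔤 k) = 0 := by
  ext u
  rw [L_apply, const_apply, map_mul, counit_j, zero_mul, mul_zero]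
  rfl

theorem const_conv_apply (k : K) (g : GFun K 𝔤 N) (u : U K 𝔤) :
    (conv (const 𝔤 k) g).1 u = k • g.1 u := by
  induction u using U.induction_left generalizing g with
  | hι l => rw [apply_ι, apply_ι, conv_one, const_apply, map_one, mul_one, smul_rsmul]
  | add u v hu hv => rw [map_add, map_add, hu, hv, smul_add]
  | hj n a ha u hu => rw [← L_apply, ← L_apply, L_conv ha, L_const, zero_conv, zero_add, hu]

theorem const_one_conv (g : GFun K 𝔤 N) : conv (const 𝔤 1) g = g := by
  ext u; rw [const_conv_apply, one_smul]

theorem counit_twist (i : ZMod 2) (u : U K 𝔤) :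
    counit K 𝔤 (twist i u) = twist i (counit K 𝔤 u) := by
  induction u using U.induction_ring with
  | hι k => rw [twist_ι, counit_ι, counit_ι]
  | hj a => rw [twist_j, counit_j, counit_j, map_zero]
  | add u v hu hv => rw [map_add, map_add, hu, hv, map_add, map_add]
  | mul u v hu hv => rw [U.twist_mul, map_mul, map_mul, hu, hv, SuperLie.twist_mul]

theorem tw_const (i : ZMod 2) (k : K) : tw i (const 𝔤 k) = const 𝔤 (twist i k) := by
  ext u
  rw [tw_apply, const_apply, const_apply, counit_twist, SuperLie.twist_mul, twist_twist]

theorem conv_const_one (f : GFun K 𝔤 K) : conv f (const 𝔤 1) = f := by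
  ext u
  induction u using U.induction_left generalizing f with
  | hι l =>
    have h1 : (const 𝔤 (1 : K)).1 1 = 1 := by rw [const_apply, map_one, mul_one]
    rw [apply_ι, apply_ι f, conv_one, h1, smul_eq_mul, mul_one]
  | add u v hu hv => rw [map_add, map_add, hu, hv]
  | hj n a ha u hu =>
    rw [← L_apply, ← L_apply, L_conv ha, L_const, conv_zero, add_zero, tw_const, twist_one, hu]

/-- The algebra `F(G)`. -/
noncomputable instance : Ring (GFun K 𝔤 K) :=
  { (inferInstance : AddCommGroup (GFun K 𝔤 K)) with
    mul := conv
    one := const 𝔤 1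
    left_distrib := conv_add
    right_distrib := add_conv
    zero_mul := zero_conv
    mul_zero := conv_zero
    mul_assoc := conv_assoc
    one_mul := const_one_conv
    mul_one := conv_const_one }

theorem mul_def (f g : GFun K 𝔤 K) : f * g = conv f g := rfl

theorem one_def : (1 : GFun K 𝔤 K) = const 𝔤 1 := rfl

end GFun
end FunctionRing

section Subalgebra
variable (K 𝔤 : Type*) [Ring K] [Algebra ℚ K] [SuperGraded K] [SuperCommRing K] [AddCommGroup 𝔤]
  [SuperGraded 𝔤] [Module K 𝔤] [LieSuperalgebra K 𝔤]

/-- A Lie subalgebra over `K`: a graded `K`-submodule that is closed under the bracket. -/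
structure LieSuperSubalgebra extends Submodule K 𝔤 where
  homog : Submodule.IsHomogeneous toSubmodule (gr 𝔤)
  br_mem' : ∀ {a b : 𝔤}, a ∈ toSubmodule → b ∈ toSubmodule →
    LieSuperalgebra.br K a b ∈ toSubmodule

variable {K 𝔤} (𝔥 : LieSuperSubalgebra K 𝔤)

theorem LieSuperSubalgebra.comp_mem (i : ZMod 2) {a : 𝔤} (ha : a ∈ 𝔥.toSubmodule) :
    comp i a ∈ 𝔥.toSubmodule := 𝔥.homog i ha

instance : SuperGraded 𝔥.toSubmodule where
  gr i := (gr 𝔤 i).comap (𝔥.toSubmodule.subtype.toAddMonoidHom.toIntLinearMap)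
  isCompl := isCompl_of
    (fun a => ⟨⟨comp 0 a.1, 𝔥.comp_mem 0 a.2⟩, comp_mem 0 a.1, ⟨comp 1 a.1, 𝔥.comp_mem 1 a.2⟩,
      comp_mem 1 a.1, Subtype.ext (comp_add_comp a.1)⟩)
    (fun a h0 h1 => Subtype.ext <|
      Submodule.disjoint_def.1 (SuperGraded.isCompl (M := 𝔤)).disjoint a.1 h0 h1)

theorem LieSuperSubalgebra.mem_gr {i : ZMod 2} {a : 𝔥.toSubmodule} :
    a ∈ gr 𝔥.toSubmodule i ↔ a.1 ∈ gr 𝔤 i := Iff.rfl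

instance : LieSuperalgebra K 𝔥.toSubmodule where
  smul_mem hk ha := SuperModule.smul_mem (M := 𝔤) hk ha
  br := AddMonoidHom.mk' (fun a => AddMonoidHom.mk'
      (fun b => ⟨LieSuperalgebra.br K a.1 b.1, 𝔥.br_mem' a.2 b.2⟩)
      fun _ _ => Subtype.ext (map_add _ _ _))
    fun a b => AddMonoidHom.ext fun c => Subtype.ext
      (DFunLike.congr_fun (map_add (LieSuperalgebra.br K) a.1 b.1) c.1)
  br_mem ha hb := LieSuperalgebra.br_mem (K := K) (𝔤 := 𝔤) ha hb
  smul_br k a b := Subtype.ext (LieSuperalgebra.smul_br k a.1 b.1)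
  skew ha hb := Subtype.ext (LieSuperalgebra.skew (K := K) (𝔤 := 𝔤) ha hb)
  jacobi c ha hb := Subtype.ext (LieSuperalgebra.jacobi (K := K) (𝔤 := 𝔤) c.1 ha hb)

theorem LieSuperSubalgebra.br_coe (a b : 𝔥.toSubmodule) :
    (LieSuperalgebra.br K a b).1 = LieSuperalgebra.br K a.1 b.1 := rfl

end Subalgebra


section Homogeneous
variable {K 𝔤 : Type*} [Ring K] [Algebra ℚ K] [SuperGraded K] [SuperCommRing K] [AddCommGroup 𝔤]
  [SuperGraded 𝔤] [Module K 𝔤] [LieSuperalgebra K 𝔤]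

theorem LieSuperSubalgebra.twist_mem (𝔥 : LieSuperSubalgebra K 𝔤) (i : ZMod 2) {a : 𝔤}
    (ha : a ∈ 𝔥.toSubmodule) : twist i a ∈ 𝔥.toSubmodule :=
  Submodule.add_mem _ (𝔥.comp_mem 0 ha) (zsmul_mem (𝔥.comp_mem 1 ha) _)

theorem GFun.comp_right {N : Type*} [AddCommGroup N] [SuperGraded N] [Module K N]
    [SuperModule K N] (f : GFun K 𝔤 N) (u : U K 𝔤) (a : 𝔤) :
    f.1 (u * U.j K 𝔤 a) =
      f.1 (u * U.j K 𝔤 (comp 0 a)) + f.1 (u * U.j K 𝔤 (comp 1 a)) := by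
  rw [← map_add, ← mul_add, ← map_add, comp_add_comp]

/-- The algebra `F(G/H)`: the orthogonal of `U(𝔤) 𝔥` in `F(G)`. -/
noncomputable def FGH (𝔥 : LieSuperSubalgebra K 𝔤) : Subring (GFun K 𝔤 K) where
  carrier := {f | ∀ a ∈ 𝔥.toSubmodule, ∀ u, f.1 (u * U.j K 𝔤 a) = 0}
  zero_mem' _ _ _ := rfl
  add_mem' {f g} hf hg a ha u := by
    simp only [AddSubgroup.coe_add, AddMonoidHom.add_apply, hf a ha u, hg a ha u, add_zero]
  neg_mem' {f} hf a ha u := by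
    simp only [AddSubgroup.coe_neg, AddMonoidHom.neg_apply, hf a ha u, neg_zero]
  one_mem' a _ u := by
    rw [GFun.one_def, GFun.const_apply, map_mul, counit_j, mul_zero, mul_zero]
  mul_mem' {f g} hf hg a ha u := by
    have key : ∀ i, ∀ b ∈ gr 𝔤 i, b ∈ 𝔥.toSubmodule → (f * g).1 (u * U.j K 𝔤 b) = 0 := by
      intro i b hb hbh
      rw [GFun.mul_def, GFun.conv_apply, map_mul, coprod_j]
      induction coprod K 𝔤 u using GFun.UU.induction with
      | add x y hx hy => rw [add_mul, map_add, hx, hy, add_zero]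
      | tmul l n u hu v hv =>
        have h1 : (GFun.tw l g).1 (v * U.j K 𝔤 b) = 0 := by
          rw [GFun.tw_apply, U.twist_mul, GFun.twist_j, hg _ (𝔥.twist_mem l hbh), map_zero]
        rw [← map_mul, GFun.pair_mk, mul_add, UZ.tmul_mul_tmul hv (U.j_mem hb),
          UZ.tmul_mul_tmul hv U.one_mem, map_add, map_zsmul, map_zsmul,
          GFun.pairZ_tmul _ _ (U.mul_mem hu (U.j_mem hb)), mul_one, mul_one,
          GFun.pairZ_tmul _ _ hu, hf b hbh, h1, zero_smul, smul_zero, smul_zero, smul_zero,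
          add_zero]
    rw [GFun.comp_right, key 0 _ (comp_mem _ _) (𝔥.comp_mem 0 ha),
      key 1 _ (comp_mem _ _) (𝔥.comp_mem 1 ha), add_zero]

section
variable (𝔥 : LieSuperSubalgebra K 𝔤) (V : Type*) [AddCommGroup V] [SuperGraded V] [Module K V]
  [SuperModule K V] [LieSuperModule K 𝔥.toSubmodule V]

/-- The coinduced module `F(G/H, V) = Hom_𝔥(U(𝔤), V)`: the subspace of those `f ∈ F(G, V)` such that
`a (f u) = -(-1)^(p(a) p(f u)) f (u j(a))` for `a ∈ 𝔥` and `u ∈ U(𝔤)`. -/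
noncomputable def Coind : AddSubgroup (GFun K 𝔤 V) where
  carrier := {f | ∀ i, ∀ a ∈ gr 𝔥.toSubmodule i, ∀ u,
    f.1 (u * U.j K 𝔤 a) = -LieSuperModule.act K a (twist i (f.1 u))}
  zero_mem' _ _ _ _ := by simp
  add_mem' {f g} hf hg i a ha u := by
    simp only [AddSubgroup.coe_add, AddMonoidHom.add_apply, hf i a ha u, hg i a ha u, map_add,
      neg_add]
  neg_mem' {f} hf i a ha u := by
    simp only [AddSubgroup.coe_neg, AddMonoidHom.neg_apply, hf i a ha u, map_neg]
end

section
variable {𝔥 : LieSuperSubalgebra K 𝔤} {V : Type*} [AddCommGroup V] [SuperGraded V] [Module K V]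
  [SuperModule K V] [LieSuperModule K 𝔥.toSubmodule V]

theorem act_twist_smul {𝔩 M : Type*} [AddCommGroup 𝔩] [SuperGraded 𝔩]
    [Module K 𝔩] [LieSuperalgebra K 𝔩] [AddCommGroup M] [SuperGraded M] [Module K M]
    [SuperModule K M] [LieSuperModule K 𝔩 M] {i : ZMod 2} {a : 𝔩} (ha : a ∈ gr 𝔩 i) (k : K)
    (m : M) : LieSuperModule.act K a (twist i k • m) = k • LieSuperModule.act K a m := by
  induction k using homog_induction with
  | add k l hk hl => rw [map_add, add_smul, map_add, hk, hl, add_smul]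
  | hom l k hk =>
    rw [twist_of_mem _ hk, smul_assoc, map_zsmul, LieSuperModule.act_smul m hk ha, smul_smul,
      ks_comm l i, ks_mul_self, one_smul]

theorem twist_act {𝔩 M : Type*} [AddCommGroup 𝔩] [SuperGraded 𝔩]
    [Module K 𝔩] [LieSuperalgebra K 𝔩] [AddCommGroup M] [SuperGraded M] [Module K M]
    [SuperModule K M] [LieSuperModule K 𝔩 M] {i : ZMod 2} {a : 𝔩} (ha : a ∈ gr 𝔩 i) (l : ZMod 2)
    (m : M) :
    twist l (LieSuperModule.act K a m) = ks l i • LieSuperModule.act K a (twist l m) := by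
  induction m using homog_induction with
  | add m n hm hn => simp only [map_add, hm, hn, smul_add]
  | hom n m hm =>
    rw [twist_of_mem _ (LieSuperModule.act_mem ha hm), twist_of_mem _ hm, map_zsmul, smul_smul,
      ks_add_right]

theorem tw_mem_FGH (l : ZMod 2) {f : GFun K 𝔤 K} (hf : f ∈ FGH 𝔥) : GFun.tw l f ∈ FGH 𝔥 := by
  intro a ha u
  rw [GFun.tw_apply, U.twist_mul, GFun.twist_j, hf _ (𝔥.twist_mem l ha), map_zero]

theorem tw_mem_Coind (l : ZMod 2) {f : GFun K 𝔤 V} (hf : f ∈ Coind 𝔥 V) :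
    GFun.tw l f ∈ Coind 𝔥 V := by
  intro i a ha u
  rw [GFun.tw_apply, U.twist_mul, GFun.twist_j, twist_of_mem l (𝔥.mem_gr.1 ha), map_zsmul,
    mul_smul_comm, map_zsmul, map_zsmul, hf i a ha, map_neg, twist_act ha, smul_neg, smul_smul,
    ks_mul_self, one_smul, GFun.tw_apply, ← twist_add, ← twist_add, add_comm]

theorem conv_mem_Coind {φ : GFun K 𝔤 K} {f : GFun K 𝔤 V} (hφ : φ ∈ FGH 𝔥) (hf : f ∈ Coind 𝔥 V) :
    GFun.conv φ f ∈ Coind 𝔥 V := by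
  intro i a ha u
  have ha' := 𝔥.mem_gr.1 ha
  rw [GFun.conv_apply, GFun.conv_apply, map_mul, coprod_j]
  induction coprod K 𝔤 u using GFun.UU.induction with
  | add x y hx hy => rw [add_mul, map_add, hx, hy, map_add, map_add, map_add, neg_add]
  | tmul l n u hu v hv =>
    rw [← map_mul, GFun.pair_mk, GFun.pair_mk, mul_add, UZ.tmul_mul_tmul hv (U.j_mem ha'),
      UZ.tmul_mul_tmul hv U.one_mem, map_add, map_zsmul, map_zsmul,
      GFun.pairZ_tmul _ _ (U.mul_mem hu (U.j_mem ha')), mul_one, mul_one,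
      GFun.pairZ_tmul _ _ hu, GFun.pairZ_tmul _ _ hu, hφ a.1 a.2, zero_smul, smul_zero, zero_add,
      ks_zero_right, one_smul, tw_mem_Coind l hf i a ha, twist_smul, act_twist_smul ha, smul_neg]

theorem L_mem_FGH (b : 𝔤) {f : GFun K 𝔤 K} (hf : f ∈ FGH 𝔥) : GFun.L b f ∈ FGH 𝔥 := by
  intro a ha u
  rw [GFun.L_apply, ← mul_assoc, hf a ha]

theorem L_mem_Coind (b : 𝔤) {f : GFun K 𝔤 V} (hf : f ∈ Coind 𝔥 V) : GFun.L b f ∈ Coind 𝔥 V := by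
  intro i a ha u
  rw [GFun.L_apply, ← mul_assoc, hf i a ha, GFun.L_apply]

/-- The `F(G/H)`-module structure of `F(G/H, V)`. -/
noncomputable instance : Module (FGH 𝔥) (Coind 𝔥 V) where
  smul φ f := ⟨GFun.conv φ.1 f.1, conv_mem_Coind φ.2 f.2⟩
  one_smul f := Subtype.ext (GFun.const_one_conv f.1)
  mul_smul φ ψ f := Subtype.ext (GFun.conv_assoc φ.1 ψ.1 f.1)
  smul_zero φ := Subtype.ext (GFun.conv_zero φ.1)
  smul_add φ f g := Subtype.ext (GFun.conv_add φ.1 f.1 g.1)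
  add_smul φ ψ f := Subtype.ext (GFun.add_conv φ.1 ψ.1 f.1)
  zero_smul f := Subtype.ext (GFun.zero_conv f.1)

theorem Coind.smul_coe (φ : FGH 𝔥) (f : Coind 𝔥 V) : (φ • f).1 = GFun.conv φ.1 f.1 := rfl

end

variable (𝔥 : LieSuperSubalgebra K 𝔤)

/-- The constant functions. -/
noncomputable def FGH.const : K →+* FGH 𝔥 where
  toFun k := ⟨GFun.const 𝔤 k, fun a _ u => by
    rw [GFun.const_apply, map_mul, counit_j, mul_zero, mul_zero]⟩
  map_one' := rfl
  map_mul' k l := Subtype.ext <| GFun.ext' fun u => by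
    change (GFun.const 𝔤 (k * l)).1 u = (GFun.conv (GFun.const 𝔤 k) (GFun.const 𝔤 l)).1 u
    rw [GFun.const_conv_apply, GFun.const_apply, GFun.const_apply, mul_assoc, smul_eq_mul]
  map_zero' := Subtype.ext <| GFun.ext' fun u => by
    change (GFun.const 𝔤 (0 : K)).1 u = 0
    rw [GFun.const_apply, zero_mul]
  map_add' k l := Subtype.ext <| GFun.ext' fun u => by
    change (GFun.const 𝔤 (k + l)).1 u = (GFun.const 𝔤 k).1 u + (GFun.const 𝔤 l).1 u
    simp only [GFun.const_apply, add_mul]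

noncomputable instance : Module K (FGH 𝔥) := Module.compHom _ (FGH.const 𝔥)

theorem FGH.smul_def (k : K) (φ : FGH 𝔥) : k • φ = FGH.const 𝔥 k * φ := rfl

/-- The elements of `F(G/H)` that are homogeneous of parity `i`. -/
noncomputable def FGH.gr (i : ZMod 2) : AddSubgroup (FGH 𝔥) :=
  (GFun.gr K 𝔤 K i).comap (FGH 𝔥).subtype.toAddMonoidHom

/-- The evaluation `δ : f ↦ f(1)`. -/
noncomputable def FGH.δ : FGH 𝔥 →+* K where
  toFun f := f.1.1 1
  map_one' := by
    change (GFun.const 𝔤 (1 : K)).1 1 = 1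
    rw [GFun.const_apply, map_one, mul_one]
  map_mul' f g := GFun.conv_one f.1 g.1
  map_zero' := rfl
  map_add' _ _ := rfl

section GAction
variable {N : Type*} [AddCommGroup N] [SuperGraded N] [Module K N] [SuperModule K N]

/-- The action `-ζ_a^λ` of `a ∈ 𝔤` on `F(G, N)`:
`(-ζ_a^λ f)(u) = -(-1)^(p(a) p(f)) f(j(a) u)`. -/
noncomputable def GFun.act : 𝔤 →+ GFun K 𝔤 N →+ GFun K 𝔤 N :=
  AddMonoidHom.mk' (fun a => -∑ i, (GFun.L (comp i a)).comp (GFun.tw i)) fun a b => by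
    ext f : 1
    simp only [AddMonoidHom.neg_apply, AddMonoidHom.finsetSum_apply, AddMonoidHom.comp_apply,
      AddMonoidHom.add_apply, map_add, GFun.L_add, Finset.sum_add_distrib, neg_add]

theorem GFun.act_of_mem {i : ZMod 2} {a : 𝔤} (ha : a ∈ SuperLie.gr 𝔤 i) (f : GFun K 𝔤 N) :
    GFun.act a f = -GFun.L a (GFun.tw i f) := by
  have h0 : GFun.L (0 : 𝔤) = (0 : GFun K 𝔤 N →+ GFun K 𝔤 N) := by
    ext f u
    rw [GFun.L_apply, map_zero, zero_mul, map_zero]; rfl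
  have : ∀ l, GFun.L (comp l a) (GFun.tw l f) = if i = l then GFun.L a (GFun.tw i f) else 0 := by
    intro l
    rw [comp_of_mem ha]
    split_ifs with h
    · rw [h]
    · rw [h0]; rfl
  change (-∑ l, (GFun.L (comp l a)).comp (GFun.tw l)) f = _
  simp only [AddMonoidHom.neg_apply, AddMonoidHom.finsetSum_apply, AddMonoidHom.comp_apply, this]
  simp

theorem GFun.act_eq (a : 𝔤) (f : GFun K 𝔤 N) :
    GFun.act a f = -(GFun.L (comp 0 a) (GFun.tw 0 f) + GFun.L (comp 1 a) (GFun.tw 1 f)) := by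
  rw [← comp_add_comp a, map_add, AddMonoidHom.add_apply, GFun.act_of_mem (comp_mem 0 a),
    GFun.act_of_mem (comp_mem 1 a), comp_add_comp, neg_add]

end GAction

/-- The action `-ζ_a^λ` of `a ∈ 𝔤` on `F(G/H)`. -/
noncomputable def FGH.act (a : 𝔤) (φ : FGH 𝔥) : FGH 𝔥 :=
  ⟨GFun.act a φ.1, by
    rw [GFun.act_eq]
    exact neg_mem (add_mem (L_mem_FGH _ (tw_mem_FGH _ φ.2)) (L_mem_FGH _ (tw_mem_FGH _ φ.2)))⟩

/-- A `𝔤`-`F(G/H)`-module: a `K`-module with compatible structures of an `F(G/H)`-module and of a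
`𝔤`-module that satisfy the Leibniz relation. -/
class GHModule (M : Type*) [AddCommGroup M] [SuperGraded M] [Module K M] [SuperModule K M]
    [LieSuperModule K 𝔤 M] [Module (FGH 𝔥) M] : Prop where
  smul_assoc : ∀ (k : K) (φ : FGH 𝔥) (m : M), (k • φ) • m = k • φ • m
  smul_mem : ∀ {i l : ZMod 2} {φ : FGH 𝔥} {m : M}, φ ∈ FGH.gr 𝔥 i → m ∈ gr M l →
    φ • m ∈ gr M (i + l)
  leibniz : ∀ {i l : ZMod 2} {a : 𝔤} {φ : FGH 𝔥} (m : M), a ∈ gr 𝔤 i → φ ∈ FGH.gr 𝔥 l →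
    LieSuperModule.act K a (φ • m) =
      FGH.act 𝔥 a φ • m + ks i l • φ • LieSuperModule.act K a m

end Homogeneous


section Decomposition
variable {K 𝔤 N : Type*} [Ring K] [Algebra ℚ K] [SuperGraded K] [SuperCommRing K] [AddCommGroup 𝔤]
  [SuperGraded 𝔤] [Module K 𝔤] [LieSuperalgebra K 𝔤] [AddCommGroup N] [SuperGraded N]
  [Module K N] [SuperModule K N]

theorem mem_gr_of_twist (K : Type*) {N : Type*} [Ring K] [Algebra ℚ K] [AddCommGroup N]
    [SuperGraded N] [Module K N] {i : ZMod 2} {m : N} (h : twist 1 m = ks 1 i • m) : m ∈ gr N i := by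
  have hN : ∀ n : N, n = -n → n = 0 := by
    intro n hn
    have h1 : n + n = 0 := by nth_rewrite 1 [hn]; exact neg_add_cancel n
    have h2 : n = algebraMap ℚ K 2⁻¹ • (n + n) := by
      rw [smul_add, ← add_smul, ← map_add, show (2⁻¹ + 2⁻¹ : ℚ) = 1 by norm_num, map_one, one_smul]
    rw [h2, h1, smul_zero]
  have h0 : twist 1 m = comp 0 m - comp 1 m := by
    simp [twist, show ks 1 1 = -1 by decide, sub_eq_add_neg]
  have hc := comp_add_comp m
  have hi : ∀ i : ZMod 2, i = 0 ∨ i = 1 := by decide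
  obtain rfl | rfl := hi i
  · rw [ks_zero_right, one_smul, h0] at h
    have h1 : comp 1 m = -comp 1 m := by
      have : comp 0 m - comp 1 m = comp 0 m + comp 1 m := by rw [h, hc]
      rw [sub_eq_add_neg] at this
      exact (add_left_cancel this).symm
    have := comp_mem 0 m
    rw [hN _ h1, add_zero] at hc
    rwa [hc] at this
  · rw [show ks 1 1 = -1 by decide, neg_smul, one_smul, h0] at h
    have h1 : comp 0 m = -comp 0 m := by
      have : -comp 1 m + comp 0 m = -comp 1 m + -comp 0 m := by
        rw [← neg_add, add_comm (comp 1 m), hc, ← h]; abel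
      exact add_left_cancel this
    have := comp_mem 1 m
    rw [hN _ h1, zero_add] at hc
    rwa [hc] at this

theorem GFun.mem_gr_of_tw {i : ZMod 2} {f : GFun K 𝔤 N} (h : tw 1 f = ks 1 i • f) :
    f ∈ gr K 𝔤 N i := by
  intro l u hu
  apply mem_gr_of_twist K
  have h1 : (tw 1 f).1 u = ks 1 i • f.1 u := by rw [h]; rfl
  rw [tw_apply, twist_of_mem _ hu, map_zsmul, map_zsmul] at h1
  rw [ks_add_right, mul_smul, smul_comm, ← h1, smul_smul, ks_mul_self, one_smul]

/-- The homogeneous component of a function. -/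
noncomputable def GFun.part (i : ZMod 2) (f : GFun K 𝔤 N) : GFun K 𝔤 N :=
  conv (const 𝔤 (algebraMap ℚ K 2⁻¹)) (f + ks 1 i • tw 1 f)

theorem GFun.part_apply (i : ZMod 2) (f : GFun K 𝔤 N) (u : U K 𝔤) :
    (part i f).1 u = algebraMap ℚ K 2⁻¹ • (f.1 u + ks 1 i • (tw 1 f).1 u) := const_conv_apply _ _ _

theorem GFun.part_mem (i : ZMod 2) (f : GFun K 𝔤 N) : part i f ∈ gr K 𝔤 N i := by
  apply mem_gr_of_tw
  rw [part, tw_conv, tw_const, twist_of_mem _ (U.rat_mem K _), ks_zero_right, one_smul, map_add,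
    map_zsmul, tw_tw, show (1 + 1 : ZMod 2) = 0 by decide, tw_zero, ← conv_zsmul, smul_add,
    smul_smul, ks_mul_self, one_smul, add_comm]

theorem GFun.part_add_part (f : GFun K 𝔤 N) : part 0 f + part 1 f = f := by
  ext u
  rw [AddSubgroup.coe_add, AddMonoidHom.add_apply, part_apply, part_apply, ← smul_add,
    ks_zero_right, one_smul, show ks 1 1 = -1 by decide, neg_smul, one_smul,
    add_add_add_comm, add_neg_cancel, add_zero, smul_add, ← add_smul, ← map_add,
    show (2⁻¹ + 2⁻¹ : ℚ) = 1 by norm_num, map_one, one_smul]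

theorem GFun.eq_zero_of_mem {f : GFun K 𝔤 N} (h0 : f ∈ gr K 𝔤 N 0) (h1 : f ∈ gr K 𝔤 N 1) :
    f = 0 := by
  ext u
  induction u using homog_induction with
  | add u v hu hv => rw [map_add, hu, hv, map_add]
  | hom l u hu =>
    have a0 := h0 l u hu
    have a1 := h1 l u hu
    have hl : ∀ l : ZMod 2, l = 0 ∨ l = 1 := by decide
    have := Submodule.disjoint_def.1 (SuperGraded.isCompl (M := N)).disjoint (f.1 u)
    obtain rfl | rfl := hl l
    · exact this a0 a1
    · exact this a1 a0

variable {𝔥 : LieSuperSubalgebra K 𝔤} {V : Type*} [AddCommGroup V] [SuperGraded V] [Module K V]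
  [SuperModule K V] [LieSuperModule K 𝔥.toSubmodule V]

theorem part_mem_FGH (i : ZMod 2) {f : GFun K 𝔤 K} (hf : f ∈ FGH 𝔥) : GFun.part i f ∈ FGH 𝔥 :=
  mul_mem (FGH.const 𝔥 (algebraMap ℚ K 2⁻¹)).2
    (add_mem hf (zsmul_mem (tw_mem_FGH 1 hf) _))

theorem part_mem_Coind (i : ZMod 2) {f : GFun K 𝔤 V} (hf : f ∈ Coind 𝔥 V) :
    GFun.part i f ∈ Coind 𝔥 V :=
  conv_mem_Coind (FGH.const 𝔥 (algebraMap ℚ K 2⁻¹)).2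
    (add_mem hf (zsmul_mem (tw_mem_Coind 1 hf) _))

/-- The homogeneous component of an element of `F(G/H)`. -/
noncomputable def FGH.part (i : ZMod 2) (φ : FGH 𝔥) : FGH 𝔥 :=
  ⟨GFun.part i φ.1, part_mem_FGH i φ.2⟩

theorem FGH.part_mem (i : ZMod 2) (φ : FGH 𝔥) : FGH.part i φ ∈ FGH.gr 𝔥 i :=
  GFun.part_mem i φ.1

theorem FGH.part_add_part (φ : FGH 𝔥) : FGH.part 0 φ + FGH.part 1 φ = φ :=
  Subtype.ext (GFun.part_add_part φ.1)

theorem FGH.δ_part (i : ZMod 2) {φ : FGH 𝔥} (h : FGH.δ 𝔥 φ = 0) : FGH.δ 𝔥 (FGH.part i φ) = 0 := by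
  change (GFun.part i φ.1).1 1 = 0
  have h1 : φ.1.1 1 = 0 := h
  rw [GFun.part_apply, GFun.tw_apply, twist_of_mem _ U.one_mem, ks_zero_right, one_smul, h1]
  simp

theorem FGH.induction {P : FGH 𝔥 → Prop} (hom : ∀ i, ∀ φ ∈ FGH.gr 𝔥 i, P φ)
    (add : ∀ φ ψ, P φ → P ψ → P (φ + ψ)) (φ : FGH 𝔥) : P φ := by
  rw [← FGH.part_add_part φ]
  exact add _ _ (hom 0 _ (FGH.part_mem _ _)) (hom 1 _ (FGH.part_mem _ _))

theorem FGH.induction_δ {P : FGH 𝔥 → Prop}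
    (hom : ∀ i, ∀ φ ∈ FGH.gr 𝔥 i, FGH.δ 𝔥 φ = 0 → P φ)
    (add : ∀ φ ψ, P φ → P ψ → P (φ + ψ)) (φ : FGH 𝔥) (h : FGH.δ 𝔥 φ = 0) : P φ := by
  rw [← FGH.part_add_part φ]
  exact add _ _ (hom 0 _ (FGH.part_mem _ _) (FGH.δ_part 0 h))
    (hom 1 _ (FGH.part_mem _ _) (FGH.δ_part 1 h))

/-! ### The `𝔤`-`F(G/H)`-module `F(G/H, V)` -/

/-- An element of `F(G/H, V)` is homogeneous of parity `i` if it maps elements of `U(𝔤)` of parity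
`l` to elements of `V` of parity `i + l`. -/
noncomputable instance : SuperGraded (Coind 𝔥 V) where
  gr i := ((GFun.gr K 𝔤 V i).comap (Coind 𝔥 V).subtype).toIntSubmodule
  isCompl := isCompl_of
    (fun f => ⟨⟨GFun.part 0 f.1, part_mem_Coind 0 f.2⟩, GFun.part_mem 0 f.1,
      ⟨GFun.part 1 f.1, part_mem_Coind 1 f.2⟩, GFun.part_mem 1 f.1,
      Subtype.ext (GFun.part_add_part f.1)⟩)
    (fun _ h0 h1 => Subtype.ext (GFun.eq_zero_of_mem h0 h1))

theorem Coind.mem_gr {i : ZMod 2} {f : Coind 𝔥 V} :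
    f ∈ gr (Coind 𝔥 V) i ↔ f.1 ∈ GFun.gr K 𝔤 V i := Iff.rfl

noncomputable instance : Module K (Coind 𝔥 V) := Module.compHom _ (FGH.const 𝔥)

theorem Coind.ksmul_apply (k : K) (f : Coind 𝔥 V) (u : U K 𝔤) :
    (k • f).1.1 u = k • f.1.1 u := GFun.const_conv_apply k f.1 u

theorem GFun.tw_of_mem' {i l : ZMod 2} {f : GFun K 𝔤 N} (hf : f ∈ gr K 𝔤 N l) :
    tw i f ∈ gr K 𝔤 N l := by
  rw [tw_of_mem hf]; exact zsmul_mem hf _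

theorem GFun.conv_mem_gr {i l : ZMod 2} {f : GFun K 𝔤 K} {g : GFun K 𝔤 N}
    (hf : f ∈ gr K 𝔤 K i) (hg : g ∈ gr K 𝔤 N l) : conv f g ∈ gr K 𝔤 N (i + l) := by
  apply mem_gr_of_tw
  rw [tw_conv, tw_of_mem hf, tw_of_mem hg, zsmul_conv, conv_zsmul, smul_smul, ks_add_right]

theorem GFun.act_mem_gr {i l : ZMod 2} {a : 𝔤} {f : GFun K 𝔤 N} (ha : a ∈ SuperLie.gr 𝔤 i)
    (hf : f ∈ gr K 𝔤 N l) : GFun.act a f ∈ gr K 𝔤 N (i + l) := by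
  rw [act_of_mem ha]
  refine neg_mem fun n u hu => ?_
  rw [L_apply, add_comm i l, add_assoc]
  exact tw_of_mem' hf _ _ (U.mul_mem (U.j_mem ha) hu)

instance : SuperModule K (Coind 𝔥 V) where
  smul_mem {i l k f} hk hf := by
    intro n u hu
    change (k • f).1.1 u ∈ _
    rw [Coind.ksmul_apply, add_assoc]
    exact SuperModule.smul_mem hk (hf n u hu)

theorem act_mem_Coind (a : 𝔤) {f : GFun K 𝔤 V} (hf : f ∈ Coind 𝔥 V) :
    GFun.act a f ∈ Coind 𝔥 V := by
  rw [GFun.act_eq]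
  exact neg_mem (add_mem (L_mem_Coind _ (tw_mem_Coind _ hf)) (L_mem_Coind _ (tw_mem_Coind _ hf)))

theorem GFun.act_apply_of_mem {i : ZMod 2} {a : 𝔤} (ha : a ∈ SuperLie.gr 𝔤 i) (f : GFun K 𝔤 N)
    (u : U K 𝔤) : (GFun.act a f).1 u = -(tw i f).1 (U.j K 𝔤 a * u) := by
  rw [act_of_mem ha]; rfl

theorem GFun.act_conv {i l : ZMod 2} {a : 𝔤} (ha : a ∈ SuperLie.gr 𝔤 i) {f : GFun K 𝔤 K}
    (hf : f ∈ gr K 𝔤 K l) (g : GFun K 𝔤 N) :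
    GFun.act a (conv f g) = conv (GFun.act a f) g + ks i l • conv f (GFun.act a g) := by
  rw [act_of_mem ha, act_of_mem ha, act_of_mem ha, tw_conv, L_conv ha, tw_tw,
    (show ∀ i : ZMod 2, i + i = 0 by decide) i, tw_zero, tw_of_mem hf, map_zsmul, zsmul_conv, zsmul_conv,
    neg_add]
  congr 1
  · rw [← zsmul_conv, ← neg_one_zsmul, ← zsmul_conv, neg_one_zsmul]
  · rw [← neg_one_zsmul (L a (tw i g)), conv_zsmul, smul_comm, neg_one_zsmul]

theorem GFun.apply_ι_mul (f : GFun K 𝔤 N) {i : ZMod 2} {k : K} (hk : k ∈ SuperLie.gr K i)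
    (u : U K 𝔤) : f.1 (U.ι K 𝔤 k * u) = k • (tw i f).1 u := by
  induction u using homog_induction with
  | add u v hu hv => rw [mul_add, map_add, hu, hv, map_add, smul_add]
  | hom l u hu =>
    have : U.ι K 𝔤 k * u = ks i l • (u * U.ι K 𝔤 k) := by
      rw [U.mul_ι hu hk, smul_smul, ks_comm i l, ks_mul_self, one_smul]
    rw [this, map_zsmul, apply_mul_ι, rsmul_twist _ hk, tw_apply, twist_of_mem _ hu, map_zsmul,
      map_zsmul, smul_comm]

theorem GFun.tw_L {i : ZMod 2} {a : 𝔤} (ha : a ∈ SuperLie.gr 𝔤 i) (l : ZMod 2)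
    (f : GFun K 𝔤 N) : tw l (L a f) = ks l i • L a (tw l f) := by
  rw [L_tw ha, smul_smul, ks_mul_self, one_smul]

theorem GFun.act_act {i l : ZMod 2} {a b : 𝔤} (ha : a ∈ SuperLie.gr 𝔤 i)
    (hb : b ∈ SuperLie.gr 𝔤 l) (f : GFun K 𝔤 N) (u : U K 𝔤) :
    (GFun.act a (GFun.act b f)).1 u =
      ks i l • (tw (i + l) f).1 (U.j K 𝔤 b * (U.j K 𝔤 a * u)) := by
  rw [act_apply_of_mem ha, act_of_mem hb, map_neg, tw_L hb, tw_tw]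
  change -(-(ks i l • (L b (tw (i + l) f)).1 (U.j K 𝔤 a * u))) = _
  rw [neg_neg, L_apply]

/-- The action of `𝔤` on `F(G/H, V)` by `-ζ_a^λ`. -/
noncomputable instance : LieSuperModule K 𝔤 (Coind 𝔥 V) where
  act := AddMonoidHom.mk' (fun a => AddMonoidHom.mk'
      (fun f => ⟨GFun.act a f.1, act_mem_Coind a f.2⟩)
      fun _ _ => Subtype.ext (map_add _ _ _))
    fun a b => AddMonoidHom.ext fun f => Subtype.ext
      (DFunLike.congr_fun (map_add GFun.act a b) f.1)
  act_mem ha hf := GFun.act_mem_gr ha hf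
  smul_act k a f := by
    refine Subtype.ext (GFun.ext' fun u => ?_)
    change (GFun.act (k • a) f.1).1 u = (GFun.conv (GFun.const 𝔤 k) (GFun.act a f.1)).1 u
    rw [GFun.const_conv_apply]
    induction a using homog_induction with
    | add a b ha hb =>
      simp only [smul_add, map_add, AddMonoidHom.add_apply, AddSubgroup.coe_add, ha, hb]
    | hom l a ha =>
    induction k using homog_induction with
    | add k l hk hl =>
      simp only [add_smul, map_add, AddMonoidHom.add_apply, AddSubgroup.coe_add, hk, hl]
    | hom i k hk =>
    rw [GFun.act_apply_of_mem (SuperModule.smul_mem hk ha), GFun.act_apply_of_mem ha, U.j_smul,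
      mul_assoc, GFun.apply_ι_mul _ hk, GFun.tw_tw, ← add_assoc,
      (show ∀ i : ZMod 2, i + i = 0 by decide) i, zero_add, smul_neg]
  act_smul {i l k a} f hk ha := by
    refine Subtype.ext ?_
    have hc : GFun.const 𝔤 k ∈ GFun.gr K 𝔤 K i := by
      apply GFun.mem_gr_of_tw
      rw [GFun.tw_const, twist_of_mem _ hk]
      ext u
      change (GFun.const 𝔤 (ks 1 i • k)).1 u = ks 1 i • (GFun.const 𝔤 k).1 u
      rw [GFun.const_apply, GFun.const_apply, smul_mul_assoc]
    have h1 : GFun.act a (GFun.const 𝔤 k) = 0 := by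
      rw [GFun.act_of_mem ha, GFun.tw_const, GFun.L_const, neg_zero]
    change GFun.act a (GFun.conv (GFun.const 𝔤 k) f.1) =
      ks i l • GFun.conv (GFun.const 𝔤 k) (GFun.act a f.1)
    rw [GFun.act_conv ha hc, h1, GFun.zero_conv, zero_add, ks_comm]
  br_act {i l a b} f ha hb := by
    refine Subtype.ext (GFun.ext' fun u => ?_)
    change (GFun.act (LieSuperalgebra.br K a b) f.1).1 u =
      (GFun.act a (GFun.act b f.1)).1 u - ks i l • (GFun.act b (GFun.act a f.1)).1 u
    rw [GFun.act_act ha hb, GFun.act_act hb ha, smul_smul, ks_comm l i, ks_mul_self, one_smul,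
      GFun.act_apply_of_mem (LieSuperalgebra.br_mem ha hb), U.j_br ha hb, add_comm l i, sub_mul,
      map_sub, neg_sub, smul_mul_assoc, map_zsmul, mul_assoc, mul_assoc]

theorem Coind.act_coe (a : 𝔤) (f : Coind 𝔥 V) :
    (LieSuperModule.act K a f).1 = GFun.act a f.1 := rfl

instance : GHModule 𝔥 (Coind 𝔥 V) where
  smul_assoc k φ f := mul_smul (FGH.const 𝔥 k) φ f
  smul_mem hφ hf := GFun.conv_mem_gr hφ hf
  leibniz f ha hφ := Subtype.ext (GFun.act_conv ha hφ f.1)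

end Decomposition


section Fibre
variable {K 𝔤 : Type*} [Ring K] [Algebra ℚ K] [SuperGraded K] [SuperCommRing K] [AddCommGroup 𝔤]
  [SuperGraded 𝔤] [Module K 𝔤] [LieSuperalgebra K 𝔤] (𝔥 : LieSuperSubalgebra K 𝔤)
  (M : Type*) [AddCommGroup M] [SuperGraded M] [Module K M] [SuperModule K M]
  [LieSuperModule K 𝔤 M] [Module (FGH 𝔥) M]

/-- The submodule `A⁺ M` of an `A`-module `M`, where `A = F(G/H)` and `A⁺` is the kernel of `δ`. -/
noncomputable def APlus : Submodule (FGH 𝔥) M :=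
  Submodule.span (FGH 𝔥) {x | ∃ φ : FGH 𝔥, FGH.δ 𝔥 φ = 0 ∧ ∃ m : M, x = φ • m}

/-- The fibre `V_M = M / A⁺ M = M ⊗_A K`, where `A = F(G/H)` acts on `K` through `δ`. -/
def Fib : Type _ := M ⧸ APlus 𝔥 M

noncomputable instance : AddCommGroup (Fib 𝔥 M) := inferInstanceAs (AddCommGroup (M ⧸ APlus 𝔥 M))

variable {M}

/-- The quotient map from `M` to its fibre. -/
noncomputable def Fib.mk : M →+ Fib 𝔥 M := (APlus 𝔥 M).mkQ.toAddMonoidHom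

theorem Fib.mk_surjective : Function.Surjective (Fib.mk 𝔥 (M := M)) :=
  (APlus 𝔥 M).mkQ_surjective

variable {𝔥}

theorem Fib.mk_eq_zero {m : M} : Fib.mk 𝔥 m = 0 ↔ m ∈ APlus 𝔥 M :=
  Submodule.Quotient.mk_eq_zero _

theorem APlus.smul_mem_of_δ {φ : FGH 𝔥} (h : FGH.δ 𝔥 φ = 0) (m : M) : φ • m ∈ APlus 𝔥 M :=
  Submodule.subset_span ⟨φ, h, m, rfl⟩

variable [GHModule 𝔥 M]

instance : IsScalarTower K (FGH 𝔥) M := ⟨GHModule.smul_assoc⟩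

noncomputable instance : Module K (Fib 𝔥 M) := inferInstanceAs (Module K (M ⧸ APlus 𝔥 M))

theorem Fib.mk_smul (k : K) (m : M) : Fib.mk 𝔥 (k • m) = k • Fib.mk 𝔥 m := rfl

theorem APlus.comp_mem (i : ZMod 2) {m : M} (hm : m ∈ APlus 𝔥 M) : comp i m ∈ APlus 𝔥 M := by
  have key : ∀ i l n (φ : FGH 𝔥) (m : M), φ ∈ FGH.gr 𝔥 l → m ∈ gr M n → φ • m ∈ APlus 𝔥 M →
      comp i (φ • m) ∈ APlus 𝔥 M := by
    intro i l n φ m hφ hm h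
    rw [comp_of_mem (GHModule.smul_mem hφ hm)]
    split_ifs
    · exact h
    · exact Submodule.zero_mem _
  induction hm using Submodule.span_induction generalizing i with
  | mem x hx =>
    obtain ⟨φ, hφ, m, rfl⟩ := hx
    refine FGH.induction_δ (P := fun φ => comp i (φ • m) ∈ APlus 𝔥 M) (fun l φ hφ h0 => ?_)
      (fun φ ψ h1 h2 => ?_) φ hφ
    swap
    · rw [add_smul, map_add]; exact Submodule.add_mem _ h1 h2
    induction m using homog_induction with
    | add m n h1 h2 => rw [smul_add, map_add]; exact Submodule.add_mem _ h1 h2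
    | hom n m hm => exact key i l n φ m hφ hm (Submodule.subset_span ⟨φ, h0, m, rfl⟩)
  | zero => rw [map_zero]; exact Submodule.zero_mem _
  | add x y _ _ hx hy => rw [map_add]; exact Submodule.add_mem _ (hx i) (hy i)
  | smul φ x _ hx =>
    rw [← comp_add_comp x, smul_add, map_add]
    induction φ using FGH.induction with
    | add φ ψ h1 h2 =>
      rw [add_smul, add_smul, map_add, map_add, add_add_add_comm]
      exact Submodule.add_mem _ h1 h2
    | hom l φ hφ =>
      exact Submodule.add_mem _
        (key i l 0 φ _ hφ (SuperLie.comp_mem _ _) (Submodule.smul_mem _ _ (hx 0)))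
        (key i l 1 φ _ hφ (SuperLie.comp_mem _ _) (Submodule.smul_mem _ _ (hx 1)))

/-- The grading of the fibre is the image of that of `M`. -/
noncomputable instance : SuperGraded (Fib 𝔥 M) where
  gr i := (gr M i).map (Fib.mk 𝔥 (M := M)).toIntLinearMap
  isCompl := isCompl_of
    (fun x => by
      obtain ⟨m, rfl⟩ := Fib.mk_surjective 𝔥 x
      exact ⟨_, ⟨comp 0 m, SuperLie.comp_mem 0 m, rfl⟩, _, ⟨comp 1 m, SuperLie.comp_mem 1 m, rfl⟩,
        by
          change Fib.mk 𝔥 _ + Fib.mk 𝔥 _ = _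
          rw [← map_add, comp_add_comp]⟩)
    (fun x h0 h1 => by
      obtain ⟨m, hm, rfl⟩ := h0
      obtain ⟨n, hn, h⟩ := h1
      change Fib.mk 𝔥 n = Fib.mk 𝔥 m at h
      change Fib.mk 𝔥 m = 0
      rw [eq_comm, ← sub_eq_zero, ← map_sub, Fib.mk_eq_zero] at h
      have := APlus.comp_mem 0 h
      rw [map_sub, comp_of_mem hm, comp_of_mem hn] at this
      rw [Fib.mk_eq_zero]
      simpa using this)

theorem Fib.mk_mem {i : ZMod 2} {m : M} (hm : m ∈ gr M i) : Fib.mk 𝔥 m ∈ gr (Fib 𝔥 M) i :=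
  ⟨m, hm, rfl⟩

theorem Fib.exists_of_mem {i : ZMod 2} {x : Fib 𝔥 M} (hx : x ∈ gr (Fib 𝔥 M) i) :
    ∃ m ∈ gr M i, Fib.mk 𝔥 m = x := hx

instance : SuperModule K (Fib 𝔥 M) where
  smul_mem hk hx := by
    obtain ⟨m, hm, rfl⟩ := Fib.exists_of_mem hx
    rw [← Fib.mk_smul]
    exact Fib.mk_mem (SuperModule.smul_mem hk hm)

theorem APlus.act_mem {a : 𝔤} (ha : a ∈ 𝔥.toSubmodule) {m : M} (hm : m ∈ APlus 𝔥 M) :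
    LieSuperModule.act K a m ∈ APlus 𝔥 M := by
  suffices H : ∀ i, ∀ a ∈ gr 𝔤 i, a ∈ 𝔥.toSubmodule → LieSuperModule.act K a m ∈ APlus 𝔥 M by
    rw [← comp_add_comp a, map_add]
    exact Submodule.add_mem _ (H 0 _ (SuperLie.comp_mem _ _) (𝔥.comp_mem 0 ha))
      (H 1 _ (SuperLie.comp_mem _ _) (𝔥.comp_mem 1 ha))
  intro i a ha hah
  have h0 : ∀ φ : FGH 𝔥, FGH.δ 𝔥 (FGH.act 𝔥 a φ) = 0 := by
    intro φ
    change (GFun.act a φ.1).1 1 = 0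
    rw [GFun.act_apply_of_mem ha, mul_one, ← one_mul (U.j K 𝔤 a), tw_mem_FGH i φ.2 a hah, neg_zero]
  induction hm using Submodule.span_induction with
  | mem x hx =>
    obtain ⟨φ, hφ, m, rfl⟩ := hx
    refine FGH.induction_δ (P := fun φ => LieSuperModule.act K a (φ • m) ∈ APlus 𝔥 M)
      (fun l φ hφ hδ => ?_) (fun φ ψ h1 h2 => ?_) φ hφ
    · rw [GHModule.leibniz m ha hφ]
      exact Submodule.add_mem _ (APlus.smul_mem_of_δ (h0 φ) m)
        (zsmul_mem (APlus.smul_mem_of_δ hδ _) _)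
    · rw [add_smul, map_add]; exact Submodule.add_mem _ h1 h2
  | zero => rw [map_zero]; exact Submodule.zero_mem _
  | add x y _ _ hx hy => rw [map_add]; exact Submodule.add_mem _ hx hy
  | smul φ x hx ih =>
    induction φ using FGH.induction with
    | add φ ψ h1 h2 => rw [add_smul, map_add]; exact Submodule.add_mem _ h1 h2
    | hom l φ hφ =>
      rw [GHModule.leibniz x ha hφ]
      exact Submodule.add_mem _ (Submodule.smul_mem _ _ hx)
        (zsmul_mem (Submodule.smul_mem _ _ ih) _)

/-- The action of `𝔥` on the fibre, induced by the action of `𝔤` on `M`. -/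
noncomputable def Fib.act : 𝔥.toSubmodule →+ Fib 𝔥 M →+ Fib 𝔥 M :=
  AddMonoidHom.mk' (fun a => QuotientAddGroup.map (APlus 𝔥 M).toAddSubgroup
      (APlus 𝔥 M).toAddSubgroup (LieSuperModule.act K a.1) fun _ hm => APlus.act_mem a.2 hm)
    fun a b => AddMonoidHom.ext fun x => by
      obtain ⟨m, rfl⟩ := Fib.mk_surjective 𝔥 x
      change Fib.mk 𝔥 (LieSuperModule.act K (a.1 + b.1) m) =
        Fib.mk 𝔥 (LieSuperModule.act K a.1 m) + Fib.mk 𝔥 (LieSuperModule.act K b.1 m)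
      rw [map_add, AddMonoidHom.add_apply, map_add]

theorem Fib.act_mk (a : 𝔥.toSubmodule) (m : M) :
    Fib.act a (Fib.mk 𝔥 m) = Fib.mk 𝔥 (LieSuperModule.act K a.1 m) := rfl

noncomputable instance : LieSuperModule K 𝔥.toSubmodule (Fib 𝔥 M) where
  act := Fib.act
  act_mem ha hx := by
    obtain ⟨m, hm, rfl⟩ := Fib.exists_of_mem hx
    exact Fib.mk_mem (LieSuperModule.act_mem (𝔥.mem_gr.1 ha) hm)
  smul_act k a x := by
    obtain ⟨m, rfl⟩ := Fib.mk_surjective 𝔥 x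
    exact congrArg (Fib.mk 𝔥) (LieSuperModule.smul_act k a.1 m)
  act_smul {i l k a} x hk ha := by
    obtain ⟨m, rfl⟩ := Fib.mk_surjective 𝔥 x
    have := congrArg (Fib.mk 𝔥) (LieSuperModule.act_smul (K := K) m hk (𝔥.mem_gr.1 ha))
    rw [map_zsmul] at this
    exact this
  br_act {i l a b} x ha hb := by
    obtain ⟨m, rfl⟩ := Fib.mk_surjective 𝔥 x
    have := congrArg (Fib.mk 𝔥) (LieSuperModule.br_act (K := K) m (𝔥.mem_gr.1 ha) (𝔥.mem_gr.1 hb))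
    rw [map_sub, map_zsmul] at this
    exact this

end Fibre

section DeltaTilde
variable {K 𝔤 : Type*} [Ring K] [Algebra ℚ K] [SuperGraded K] [SuperCommRing K] [AddCommGroup 𝔤]
  [SuperGraded 𝔤] [Module K 𝔤] [LieSuperalgebra K 𝔤]

variable (K 𝔤) in
/-- The map `w ↦ -(-1)^(p(a) p(w)) j(a) w` on `U(𝔤)`. -/
noncomputable def rightAct : 𝔤 →+ U K 𝔤 →+ U K 𝔤 :=
  AddMonoidHom.mk' (fun a => -∑ i, (AddMonoidHom.mulLeft (U.j K 𝔤 (comp i a))).comp (twist i))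
    fun a b => by
      ext w
      simp only [AddMonoidHom.neg_apply, AddMonoidHom.finsetSum_apply, AddMonoidHom.comp_apply,
        AddMonoidHom.add_apply, map_add, AddMonoidHom.coe_mulLeft, add_mul,
        Finset.sum_add_distrib, neg_add]

theorem rightAct_of_mem {i : ZMod 2} {a : 𝔤} (ha : a ∈ gr 𝔤 i) (w : U K 𝔤) :
    rightAct K 𝔤 a w = -(U.j K 𝔤 a * twist i w) := by
  have : ∀ l, U.j K 𝔤 (comp l a) * twist l w = if i = l then U.j K 𝔤 a * twist i w else 0 := by
    intro l
    rw [comp_of_mem ha]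
    split_ifs with h
    · rw [h]
    · rw [map_zero, zero_mul]
  change (-∑ l, (AddMonoidHom.mulLeft (U.j K 𝔤 (comp l a))).comp (twist l) : U K 𝔤 →+ U K 𝔤) w = _
  simp only [AddMonoidHom.neg_apply, AddMonoidHom.finsetSum_apply, AddMonoidHom.comp_apply,
    AddMonoidHom.coe_mulLeft, this]
  simp

variable (K 𝔤) in
/-- The right action of `U(𝔤)` on itself such that `w` is mapped by `k ∈ K` to `w k` and by
`a ∈ 𝔤` to `-(-1)^(p(a) p(w)) j(a) w`. -/
noncomputable def antipodeAux : U K 𝔤 →+* (AddMonoid.End (U K 𝔤))ᵐᵒᵖ :=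
  U.lift
    { toFun k := .op (AddMonoidHom.mulRight (U.ι K 𝔤 k))
      map_one' := MulOpposite.unop_injective <| AddMonoidHom.ext fun w => by
        change w * U.ι K 𝔤 1 = w
        rw [map_one, mul_one]
      map_mul' k l := MulOpposite.unop_injective <| AddMonoidHom.ext fun w => by
        change w * U.ι K 𝔤 (k * l) = w * U.ι K 𝔤 k * U.ι K 𝔤 l
        rw [map_mul, mul_assoc]
      map_zero' := MulOpposite.unop_injective <| AddMonoidHom.ext fun w => by
        change w * U.ι K 𝔤 0 = 0
        rw [map_zero, mul_zero]
      map_add' k l := MulOpposite.unop_injective <| AddMonoidHom.ext fun w => by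
        change w * U.ι K 𝔤 (k + l) = w * U.ι K 𝔤 k + w * U.ι K 𝔤 l
        rw [map_add, mul_add] }
    (AddMonoidHom.mk' (fun a => .op (rightAct K 𝔤 a))
      fun a b => MulOpposite.unop_injective (map_add (rightAct K 𝔤) a b))
    (fun k a => MulOpposite.unop_injective <| AddMonoidHom.ext fun w => by
      change rightAct K 𝔤 (k • a) w = rightAct K 𝔤 a (w * U.ι K 𝔤 k)
      induction a using homog_induction with
      | add a b ha hb => simp only [smul_add, map_add, AddMonoidHom.add_apply, ha, hb]
      | hom l a ha =>
      induction k using homog_induction with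
      | add k k' hk hk' => simp only [add_smul, map_add, AddMonoidHom.add_apply, hk, hk', mul_add]
      | hom i k hk =>
      induction w using homog_induction with
      | add v w hv hw => simp only [map_add, hv, hw, add_mul]
      | hom n w hw =>
      have hs : ∀ i l n : ZMod 2, ks (i + l) n = ks l (n + i) * ks n i * ks l i := by decide
      rw [rightAct_of_mem (SuperModule.smul_mem hk ha), rightAct_of_mem ha, twist_of_mem _ hw,
        twist_of_mem _ (U.mul_mem hw (U.ι_mem hk)), U.mul_ι hw hk, U.j_smul, mul_smul_comm,
        mul_smul_comm, mul_smul_comm, ← mul_assoc, U.j_mul_ι ha hk, smul_mul_assoc, smul_smul,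
        smul_smul, hs, mul_assoc])
    (fun i l a k ha hk => MulOpposite.unop_injective <| AddMonoidHom.ext fun w => by
      change rightAct K 𝔤 a w * U.ι K 𝔤 k = ks i l • rightAct K 𝔤 a (w * U.ι K 𝔤 k)
      rw [rightAct_of_mem ha, rightAct_of_mem ha, U.twist_mul, twist_of_mem _ (U.ι_mem hk),
        mul_smul_comm, mul_smul_comm, smul_neg, smul_smul, ks_mul_self, one_smul, neg_mul,
        mul_assoc])
    (fun i l a b ha hb => MulOpposite.unop_injective <| AddMonoidHom.ext fun w => by
      change rightAct K 𝔤 (LieSuperalgebra.br K a b) w =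
        rightAct K 𝔤 b (rightAct K 𝔤 a w) - ks i l • rightAct K 𝔤 a (rightAct K 𝔤 b w)
      rw [rightAct_of_mem (LieSuperalgebra.br_mem ha hb), rightAct_of_mem ha, rightAct_of_mem hb,
        rightAct_of_mem ha, rightAct_of_mem hb, map_neg, map_neg, U.twist_mul, U.twist_mul,
        ← twist_add, ← twist_add, twist_of_mem _ (U.j_mem ha), twist_of_mem _ (U.j_mem hb),
        mul_neg, mul_neg, neg_neg, neg_neg, U.j_br ha hb, add_comm l i, smul_mul_assoc,
        smul_mul_assoc, mul_smul_comm, mul_smul_comm, smul_smul, ks_mul_self, one_smul, sub_mul,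
        smul_mul_assoc, neg_sub, ks_comm l i, mul_assoc, mul_assoc])

variable (K 𝔤) in
/-- The antipode `S` of `U(𝔤)`: the even `K`-linear map with `S(1) = 1`, `S(j(a)) = -j(a)` and
`S(u v) = (-1)^(p(u) p(v)) S(v) S(u)`. -/
noncomputable def antipode : U K 𝔤 →+ U K 𝔤 :=
  AddMonoidHom.mk' (fun u => (antipodeAux K 𝔤 u).unop 1) fun u v => by
    rw [map_add]; rfl

theorem antipodeAux_ι (k : K) (w : U K 𝔤) :
    (antipodeAux K 𝔤 (U.ι K 𝔤 k)).unop w = w * U.ι K 𝔤 k := by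
  unfold antipodeAux
  rw [U.lift_ι]; rfl

theorem antipodeAux_j {i : ZMod 2} {a : 𝔤} (ha : a ∈ gr 𝔤 i) (w : U K 𝔤) :
    (antipodeAux K 𝔤 (U.j K 𝔤 a)).unop w = -(U.j K 𝔤 a * twist i w) := by
  rw [← rightAct_of_mem ha]
  unfold antipodeAux
  rw [U.lift_j]; rfl

theorem antipodeAux_mul (u v w : U K 𝔤) : (antipodeAux K 𝔤 (u * v)).unop w =
    (antipodeAux K 𝔤 v).unop ((antipodeAux K 𝔤 u).unop w) := by
  rw [map_mul]; rfl

theorem antipode_apply (u : U K 𝔤) : antipode K 𝔤 u = (antipodeAux K 𝔤 u).unop 1 := rfl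

theorem antipode_ι (k : K) : antipode K 𝔤 (U.ι K 𝔤 k) = U.ι K 𝔤 k := by
  rw [antipode_apply, antipodeAux_ι, one_mul]

theorem antipode_j (a : 𝔤) : antipode K 𝔤 (U.j K 𝔤 a) = -U.j K 𝔤 a := by
  induction a using homog_induction with
  | add a b ha hb => simp only [map_add, ha, hb, neg_add]
  | hom i a ha =>
    rw [antipode_apply, antipodeAux_j ha, twist_of_mem _ U.one_mem, ks_zero_right, one_smul, mul_one]

theorem antipodeAux_neg (u w : U K 𝔤) :
    (antipodeAux K 𝔤 u).unop (-w) = -(antipodeAux K 𝔤 u).unop w := AddMonoidHom.map_neg _ w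

theorem antipodeAux_zsmul (u : U K 𝔤) (n : ℤ) (w : U K 𝔤) :
    (antipodeAux K 𝔤 u).unop (n • w) = n • (antipodeAux K 𝔤 u).unop w :=
  map_zsmul ((antipodeAux K 𝔤 u).unop : U K 𝔤 →+ U K 𝔤) n w

theorem antipodeAux_smul (n : ℤ) (u w : U K 𝔤) :
    (antipodeAux K 𝔤 (n • u)).unop w = n • (antipodeAux K 𝔤 u).unop w := by
  rw [map_zsmul]; rfl

theorem antipodeAux_add (u v w : U K 𝔤) : (antipodeAux K 𝔤 (u + v)).unop w =
    (antipodeAux K 𝔤 u).unop w + (antipodeAux K 𝔤 v).unop w := by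
  rw [map_add]; rfl

theorem antipodeAux_twist (v : U K 𝔤) (m : ZMod 2) {n : ZMod 2} {w : U K 𝔤}
    (hw : w ∈ gr (U K 𝔤) n) :
    (antipodeAux K 𝔤 (twist m v)).unop w = antipode K 𝔤 (twist (n + m) v) * w := by
  induction v using U.induction_left generalizing m n w with
  | hι k =>
    rw [GFun.twist_ι, GFun.twist_ι, antipodeAux_ι, antipode_ι]
    induction k using homog_induction with
    | add k l hk hl => simp only [map_add, mul_add, add_mul, hk, hl]
    | hom i k hk =>
      rw [twist_of_mem _ hk, twist_of_mem _ hk, map_zsmul, map_zsmul, mul_smul_comm,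
        smul_mul_assoc, U.mul_ι hw hk, smul_smul, ks_add_left, mul_comm]
  | add u v hu hv =>
    rw [map_add, antipodeAux_add, hu m hw, hv m hw, map_add, map_add, add_mul]
  | hj i a ha u hu =>
    rw [U.twist_mul, U.twist_mul, twist_of_mem _ (U.j_mem ha), twist_of_mem _ (U.j_mem ha),
      smul_mul_assoc, smul_mul_assoc, antipodeAux_smul, antipodeAux_mul, antipodeAux_j ha,
      twist_of_mem _ hw, antipodeAux_neg, mul_smul_comm, antipodeAux_zsmul,
      hu m (U.mul_mem (U.j_mem ha) hw), map_zsmul, antipode_apply (U.j K 𝔤 a * _),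
      antipodeAux_mul, antipodeAux_j ha, twist_of_mem _ U.one_mem, ks_zero_right, one_smul,
      mul_one, antipodeAux_neg, hu (n + m) (U.j_mem ha), smul_neg, smul_neg, neg_mul,
      smul_mul_assoc, smul_smul, mul_assoc, ks_add_left n m i, mul_comm (ks m i), ks_comm i n,
      add_assoc]

theorem antipode_mul {i l : ZMod 2} {u v : U K 𝔤} (hu : u ∈ gr (U K 𝔤) i)
    (hv : v ∈ gr (U K 𝔤) l) :
    antipode K 𝔤 (u * v) = ks i l • (antipode K 𝔤 v * antipode K 𝔤 u) := by
  have hS : antipode K 𝔤 u ∈ gr (U K 𝔤) i := by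
    have key : ∀ u : U K 𝔤, antipode K 𝔤 (twist 1 u) = twist 1 (antipode K 𝔤 u) := by
      intro u
      induction u using U.induction_left with
      | hι k => rw [GFun.twist_ι, antipode_ι, antipode_ι, GFun.twist_ι]
      | add u v hu hv => simp only [map_add, hu, hv]
      | hj i a ha u hu =>
        have h : ∀ x : U K 𝔤, antipode K 𝔤 (U.j K 𝔤 a * x) =
            -(antipode K 𝔤 (twist i x) * U.j K 𝔤 a) := by
          intro x
          have := antipodeAux_twist x 0 (U.j_mem ha)
          rw [twist_zero, add_zero] at this
          rw [antipode_apply, antipodeAux_mul, ← antipode_apply, antipode_j, antipodeAux_neg, this]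
        have h2 : antipode K 𝔤 (twist i (twist 1 u)) = twist 1 (antipode K 𝔤 (twist i u)) := by
          have hi : ∀ i : ZMod 2, i = 0 ∨ i = 1 := by decide
          obtain h0 | h0 := hi i
          · rw [h0, twist_zero, twist_zero, hu]
          · rw [h0, hu, twist_twist, twist_twist]
        rw [U.twist_mul, twist_of_mem _ (U.j_mem ha), smul_mul_assoc, map_zsmul, h, h, map_neg,
          U.twist_mul, twist_of_mem _ (U.j_mem ha), h2, mul_smul_comm, smul_neg]
    rw [U.mem_gr, U.parity_eq_twist, ← key, twist_of_mem _ hu, map_zsmul]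
  have := antipodeAux_twist v 0 hS
  rw [twist_zero, add_zero, twist_of_mem _ hv, map_zsmul, smul_mul_assoc] at this
  rw [antipode_apply, antipodeAux_mul, ← antipode_apply, this]

variable (K) in
/-- The action of `U(𝔤)` on a `𝔤`-module. -/
noncomputable def toEnd (𝔤 M : Type*) [AddCommGroup 𝔤] [SuperGraded 𝔤] [Module K 𝔤]
    [LieSuperalgebra K 𝔤] [AddCommGroup M] [SuperGraded M] [Module K M] [SuperModule K M]
    [LieSuperModule K 𝔤 M] : U K 𝔤 →+* AddMonoid.End M :=
  U.lift (B := AddMonoid.End M) (Module.toAddMonoidEnd K M)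
    ((LieSuperModule.act K : 𝔤 →+ M →+ M) : 𝔤 →+ AddMonoid.End M)
    (fun k a => AddMonoidHom.ext fun m => LieSuperModule.smul_act k a m)
    (fun i l a k ha hk => AddMonoidHom.ext fun m => by
      rw [ks_comm i l]; exact LieSuperModule.act_smul m hk ha)
    (fun i l a b ha hb => AddMonoidHom.ext fun m => LieSuperModule.br_act m ha hb)

section
variable (𝔥 : LieSuperSubalgebra K 𝔤) {M : Type*} [AddCommGroup M] [SuperGraded M] [Module K M]
  [SuperModule K M] [LieSuperModule K 𝔤 M] [Module (FGH 𝔥) M]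

theorem toEnd_ι (k : K) (m : M) : toEnd K 𝔤 M (U.ι K 𝔤 k) m = k • m := by
  exact DFunLike.congr_fun (U.lift_ι (B := AddMonoid.End M) _ _ _ _ _ k) m

theorem toEnd_j (a : 𝔤) (m : M) : toEnd K 𝔤 M (U.j K 𝔤 a) m = LieSuperModule.act K a m := by
  exact DFunLike.congr_fun (U.lift_j (B := AddMonoid.End M) _ _ _ _ _ a) m

/-- The map `δ̃`: for `v ∈ M`, the function `u ↦ (-1)^(p(u) p(v)) δ̄(S(u) v)` on `U(𝔤)` with values in
the fibre of `M`, where `δ̄` is the quotient map from `M` to its fibre. -/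
noncomputable def deltaTilde (v : M) : U K 𝔤 →+ Fib 𝔥 M :=
  AddMonoidHom.mk' (fun u => ∑ i, Fib.mk 𝔥 (toEnd K 𝔤 M (antipode K 𝔤 (comp i u)) (twist i v)))
    fun u w => by
      rw [← Finset.sum_add_distrib]
      refine Finset.sum_congr rfl fun i _ => ?_
      rw [map_add, map_add, map_add, ← map_add (Fib.mk 𝔥)]; rfl

theorem deltaTilde_apply {i l : ZMod 2} {u : U K 𝔤} {v : M} (hu : u ∈ gr (U K 𝔤) i)
    (hv : v ∈ gr M l) :
    deltaTilde 𝔥 v u = ks i l • Fib.mk 𝔥 (toEnd K 𝔤 M (antipode K 𝔤 u) v) := by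
  have : ∀ n, Fib.mk 𝔥 (toEnd K 𝔤 M (antipode K 𝔤 (comp n u)) (twist n v)) =
      if i = n then ks i l • Fib.mk 𝔥 (toEnd K 𝔤 M (antipode K 𝔤 u) v) else 0 := by
    intro n
    rw [comp_of_mem hu]
    split_ifs with h
    · rw [← h, twist_of_mem _ hv, map_zsmul, map_zsmul]
    · rw [map_zero, map_zero, AddMonoid.End.zero_apply, map_zero]
  change ∑ n, Fib.mk 𝔥 (toEnd K 𝔤 M (antipode K 𝔤 (comp n u)) (twist n v)) = _
  simp only [this]
  simp

/-- `M` is free of finite rank over `F(G/H)`: it has a finite basis that consists of homogeneous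
elements. -/
def IsFreeOfFiniteRank (M : Type*) [AddCommGroup M] [SuperGraded M] [Module (FGH 𝔥) M] : Prop :=
  ∃ (n : ℕ) (b : Module.Basis (Fin n) (FGH 𝔥) M), ∀ i, ∃ p, b i ∈ gr M p

end

end DeltaTilde

end SuperLie

/-!
Let `A = F(G/H)`, let `b i` be a homogeneous basis of `𝒱` over `A`, and let `e i = δ̃(b i)`. A
direct computation shows that `δ̃` takes values in `F(G/H, V)`, where `V` is the fibre of `𝒱`, and that it
is linear over `K` and equivariant under `𝔤`; it is linear over `A` because `δ̃(φ v)` and `φ δ̃(v)`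
agree at `1` and satisfy the same Leibniz rule (`deltaFun_smul`). So `δ̃(∑ φᵢ bᵢ) = ∑ φᵢ eᵢ`, and it
has to be shown that every element of `F(G/H, V)` is, in a unique way, a combination of the `e i`
with coefficients in `A`. The values `e i (1)` are the classes of the `b i`, hence a basis of `V`
over `K` (`Fib.exists_basis`).

The argument takes place in the larger space `F(G, V)`, with coefficients in `F(G)`, filtered by the
order of vanishing at the identity (`GFun.vanishing`). This filtration is separated and complete,
since each element of `U(𝔤)` is a sum of products of boundedly many elements of `𝔤`. To leading
order the combination `∑ φᵢ eᵢ` is determined by the values `e i (1)`. Therefore `∑ φᵢ eᵢ` vanishes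
to order `n` only if all `φᵢ` do (`GFun.mem_vanishing_of_sum_conv_mem`), which gives uniqueness, and
successive approximation writes each `f ∈ F(G, V)` as `∑ φᵢ eᵢ` (`GFun.exists_eq_sum_conv`).

If `f` is `𝔥`-equivariant, the coefficients belong to `A`: differentiating `f = ∑ φᵢ eᵢ` from the
right along `a ∈ 𝔥`, and using the equivariance of `f` and of the `e i`, one obtains a combination
of the `e i`, up to sign, that vanishes and has the right derivatives of the `φᵢ` as coefficients. By
uniqueness these derivatives are zero (`GFun.mem_FGH_of_sum_conv_mem_Coind`).
-/

namespace SuperLie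

set_option linter.unusedSectionVars false

/-! ### Parities in the enveloping algebra -/

section Antipode
variable {K 𝔤 : Type*} [Ring K] [Algebra ℚ K] [SuperGraded K] [SuperCommRing K] [AddCommGroup 𝔤]
  [SuperGraded 𝔤] [Module K 𝔤] [LieSuperalgebra K 𝔤]

theorem U.comp_ι (i : ZMod 2) (k : K) : comp i (U.ι K 𝔤 k) = U.ι K 𝔤 (comp i k) := by
  induction k using homog_induction with
  | hom l k hk =>
    rw [comp_of_mem hk, comp_of_mem (U.ι_mem hk)]
    split_ifs
    · rfl
    · rw [map_zero]
  | add k k' hk hk' => simp only [map_add, hk, hk']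

theorem U.comp_j_mul {i : ZMod 2} {a : 𝔤} (ha : a ∈ gr 𝔤 i) (l : ZMod 2) (u : U K 𝔤) :
    comp l (U.j K 𝔤 a * u) = U.j K 𝔤 a * comp (l + i) u := by
  induction u using homog_induction with
  | hom n u hu =>
    have h : ∀ i l n : ZMod 2, i + n = l ↔ n = l + i := by decide
    rw [comp_of_mem hu, comp_of_mem (U.mul_mem (U.j_mem ha) hu)]
    simp only [h i l n]
    split_ifs
    · rfl
    · rw [mul_zero]
  | add u v hu hv => simp only [map_add, mul_add, hu, hv]

/-- Induction on the length of monomials, for a property of homogeneous elements that may depend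
on their parity. -/
theorem U.induction_homog {P : ZMod 2 → U K 𝔤 → Prop}
    (hι : ∀ i, ∀ k ∈ gr K i, P i (U.ι K 𝔤 k))
    (add : ∀ i u v, P i u → P i v → P i (u + v))
    (hj : ∀ i l, ∀ a ∈ gr 𝔤 i, ∀ u ∈ gr (U K 𝔤) l, P l u → P (i + l) (U.j K 𝔤 a * u))
    {i : ZMod 2} {u : U K 𝔤} (hu : u ∈ gr (U K 𝔤) i) : P i u := by
  have key : ∀ l, P l (comp l u) := by
    clear hu
    induction u using U.induction_left with
    | hι k => intro l; rw [U.comp_ι]; exact hι l _ (comp_mem l k)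
    | add u v hu hv => intro l; rw [map_add]; exact add _ _ _ (hu l) (hv l)
    | hj i a ha u hu =>
      intro l
      have h := hj i (l + i) a ha _ (comp_mem _ u) (hu _)
      rw [(show ∀ i l : ZMod 2, i + (l + i) = l by decide) i l] at h
      rwa [U.comp_j_mul ha]
  have h := key i
  rwa [comp_of_mem hu, if_pos rfl] at h

theorem antipode_mem {i : ZMod 2} {u : U K 𝔤} (hu : u ∈ gr (U K 𝔤) i) :
    antipode K 𝔤 u ∈ gr (U K 𝔤) i := by
  refine U.induction_homog (P := fun i u => antipode K 𝔤 u ∈ gr (U K 𝔤) i)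
    (fun i k hk => ?_) (fun i u v hu hv => ?_) (fun i l a ha u hu h => ?_) hu
  · rw [antipode_ι]; exact U.ι_mem hk
  · rw [map_add]; exact Submodule.add_mem _ hu hv
  · rw [antipode_mul (U.j_mem ha) hu, antipode_j, add_comm]
    exact Submodule.smul_mem _ _ (U.mul_mem h (Submodule.neg_mem _ (U.j_mem ha)))

theorem toEnd_mul_apply {M : Type*} [AddCommGroup M] [SuperGraded M] [Module K M]
    [SuperModule K M] [LieSuperModule K 𝔤 M] (u w : U K 𝔤) (m : M) :
    toEnd K 𝔤 M (u * w) m = toEnd K 𝔤 M u (toEnd K 𝔤 M w m) := by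
  rw [map_mul]; rfl

theorem toEnd_neg_apply {M : Type*} [AddCommGroup M] [SuperGraded M] [Module K M]
    [SuperModule K M] [LieSuperModule K 𝔤 M] (u : U K 𝔤) (m : M) :
    toEnd K 𝔤 M (-u) m = -toEnd K 𝔤 M u m := by
  rw [map_neg]; rfl

theorem toEnd_zsmul_apply {M : Type*} [AddCommGroup M] [SuperGraded M] [Module K M]
    [SuperModule K M] [LieSuperModule K 𝔤 M] (n : ℤ) (u : U K 𝔤) (m : M) :
    toEnd K 𝔤 M (n • u) m = n • toEnd K 𝔤 M u m := by
  rw [map_zsmul]; rfl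

theorem toEnd_mem {M : Type*} [AddCommGroup M] [SuperGraded M] [Module K M]
    [SuperModule K M] [LieSuperModule K 𝔤 M] {i l : ZMod 2} {u : U K 𝔤} {m : M}
    (hu : u ∈ gr (U K 𝔤) i) (hm : m ∈ gr M l) : toEnd K 𝔤 M u m ∈ gr M (i + l) := by
  refine U.induction_homog (P := fun i u => toEnd K 𝔤 M u m ∈ gr M (i + l))
    (fun i k hk => ?_) (fun i u v hu hv => ?_) (fun i n a ha u hu h => ?_) hu
  · rw [toEnd_ι]; exact SuperModule.smul_mem hk hm
  · rw [map_add]; exact Submodule.add_mem _ hu hv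
  · rw [toEnd_mul_apply, toEnd_j, add_assoc]
    exact LieSuperModule.act_mem ha h

end Antipode

/-! ### The map `δ̃` -/

section DeltaTilde
variable {K 𝔤 : Type*} [Ring K] [Algebra ℚ K] [SuperGraded K] [SuperCommRing K] [AddCommGroup 𝔤]
  [SuperGraded 𝔤] [Module K 𝔤] [LieSuperalgebra K 𝔤] (𝔥 : LieSuperSubalgebra K 𝔤) {M : Type*}
  [AddCommGroup M] [SuperGraded M] [Module K M] [SuperModule K M] [LieSuperModule K 𝔤 M]
  [Module (FGH 𝔥) M]

theorem deltaTilde_add (v w : M) : deltaTilde 𝔥 (v + w) = deltaTilde 𝔥 v + deltaTilde 𝔥 w := by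
  ext u
  change ∑ i, Fib.mk 𝔥 (toEnd K 𝔤 M (antipode K 𝔤 (comp i u)) (twist i (v + w))) =
    ∑ i, Fib.mk 𝔥 (toEnd K 𝔤 M (antipode K 𝔤 (comp i u)) (twist i v)) +
      ∑ i, Fib.mk 𝔥 (toEnd K 𝔤 M (antipode K 𝔤 (comp i u)) (twist i w))
  simp only [map_add, Finset.sum_add_distrib]

theorem deltaTilde_one (v : M) : deltaTilde 𝔥 v 1 = Fib.mk 𝔥 v := by
  have h1 : antipode K 𝔤 1 = 1 := by rw [← map_one (U.ι K 𝔤), antipode_ι]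
  induction v using homog_induction with
  | add v w hv hw => rw [deltaTilde_add, AddMonoidHom.add_apply, hv, hw, map_add]
  | hom l v hv =>
    rw [deltaTilde_apply 𝔥 U.one_mem hv, ks_zero_left, one_smul, h1, map_one]
    rfl

variable [GHModule 𝔥 M]

theorem deltaTilde_mem {i l : ZMod 2} {u : U K 𝔤} {v : M} (hu : u ∈ gr (U K 𝔤) i)
    (hv : v ∈ gr M l) : deltaTilde 𝔥 v u ∈ gr (Fib 𝔥 M) (l + i) := by
  rw [deltaTilde_apply 𝔥 hu hv, add_comm]
  exact Submodule.smul_mem _ _ (Fib.mk_mem (toEnd_mem (antipode_mem hu) hv))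

theorem deltaTilde_mul_ι (v : M) (u : U K 𝔤) (k : K) :
    deltaTilde 𝔥 v (u * U.ι K 𝔤 k) = rsmul (deltaTilde 𝔥 v u) k := by
  induction v using homog_induction with
  | add v w hv hw => simp only [deltaTilde_add, AddMonoidHom.add_apply, hv, hw, add_rsmul]
  | hom l v hv =>
  induction u using homog_induction with
  | add u w hu hw => simp only [add_mul, map_add, hu, hw, add_rsmul]
  | hom i u hu =>
  induction k using homog_induction with
  | add k k' hk hk' => simp only [map_add, mul_add, hk, hk', rsmul_add]
  | hom n k hk =>
    have hs : ∀ i l n : ZMod 2, ks (i + n) l * ks i n = ks (l + i) n * ks i l := by decide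
    rw [rsmul_homog (deltaTilde_mem 𝔥 hu hv) hk, deltaTilde_apply 𝔥 hu hv,
      deltaTilde_apply 𝔥 (U.mul_mem hu (U.ι_mem hk)) hv, antipode_mul hu (U.ι_mem hk), antipode_ι,
      toEnd_zsmul_apply, toEnd_mul_apply, toEnd_ι, map_zsmul,
      Fib.mk_smul, smul_smul, hs, smul_comm k, smul_smul]

/-- The map `δ̃`, with values in the space of formal functions on `G`. -/
noncomputable def deltaFun : M →+ GFun K 𝔤 (Fib 𝔥 M) :=
  AddMonoidHom.mk' (fun v => ⟨deltaTilde 𝔥 v, deltaTilde_mul_ι 𝔥 v⟩)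
    fun v w => Subtype.ext (deltaTilde_add 𝔥 v w)

theorem deltaFun_apply (v : M) (u : U K 𝔤) : (deltaFun 𝔥 v).1 u = deltaTilde 𝔥 v u := rfl

theorem deltaFun_one (v : M) : (deltaFun 𝔥 v).1 1 = Fib.mk 𝔥 v := deltaTilde_one 𝔥 v

theorem deltaFun_mem_gr {i : ZMod 2} {v : M} (hv : v ∈ gr M i) :
    deltaFun 𝔥 v ∈ GFun.gr K 𝔤 (Fib 𝔥 M) i := fun _ _ hu => deltaTilde_mem 𝔥 hu hv

theorem deltaFun_mem_Coind (v : M) : deltaFun 𝔥 v ∈ Coind 𝔥 (Fib 𝔥 M) := by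
  intro n a ha u
  rw [deltaFun_apply, deltaFun_apply]
  induction v using homog_induction with
  | add v w hv hw => simp only [deltaTilde_add, AddMonoidHom.add_apply, hv, hw, map_add, neg_add]
  | hom l v hv =>
  induction u using homog_induction with
  | add u w hu hw => simp only [add_mul, map_add, hu, hw, neg_add]
  | hom i u hu =>
    have ha' := 𝔥.mem_gr.1 ha
    have hs : ∀ i l n : ZMod 2, ks (i + n) l * ks i n = ks n (l + i) * ks i l := by decide
    have hact : LieSuperModule.act K a (Fib.mk 𝔥 (toEnd K 𝔤 M (antipode K 𝔤 u) v)) =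
      Fib.mk 𝔥 (LieSuperModule.act K a.1 (toEnd K 𝔤 M (antipode K 𝔤 u) v)) := Fib.act_mk _ _
    rw [twist_of_mem _ (deltaTilde_mem 𝔥 hu hv), deltaTilde_apply 𝔥 hu hv,
      deltaTilde_apply 𝔥 (U.mul_mem hu (U.j_mem ha')) hv, antipode_mul hu (U.j_mem ha'),
      antipode_j, toEnd_zsmul_apply, toEnd_mul_apply, toEnd_neg_apply, toEnd_j, map_zsmul,
      map_neg, smul_smul, hs, smul_neg, smul_smul,
      map_zsmul, hact]

theorem deltaFun_act (a : 𝔤) (v : M) :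
    deltaFun 𝔥 (LieSuperModule.act K a v) = GFun.act a (deltaFun 𝔥 v) := by
  induction a using homog_induction with
  | add a b ha hb => simp only [map_add, AddMonoidHom.add_apply, ha, hb]
  | hom n a ha =>
  induction v using homog_induction with
  | add v w hv hw => simp only [map_add, hv, hw]
  | hom l v hv =>
  ext u
  induction u using homog_induction with
  | add u w hu hw => simp only [map_add, hu, hw]
  | hom i u hu =>
    have hs : ∀ i l n : ZMod 2, ks i (n + l) = ks n l * (ks (n + i) l * ks n i) := by decide
    rw [GFun.act_apply_of_mem ha, GFun.tw_of_mem (deltaFun_mem_gr 𝔥 hv)]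
    change deltaTilde 𝔥 _ u = -(ks n l • deltaTilde 𝔥 v (U.j K 𝔤 a * u))
    rw [deltaTilde_apply 𝔥 hu (LieSuperModule.act_mem ha hv),
      deltaTilde_apply 𝔥 (U.mul_mem (U.j_mem ha) hu) hv, antipode_mul (U.j_mem ha) hu,
      antipode_j, toEnd_zsmul_apply, toEnd_mul_apply, toEnd_neg_apply, toEnd_j, map_zsmul,
      map_neg, map_neg, smul_neg, smul_neg, smul_neg,
      neg_neg, smul_smul, smul_smul, hs, mul_assoc]

theorem FGH.const_smul (k : K) (v : M) : FGH.const 𝔥 k • v = k • v := by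
  rw [← mul_one (FGH.const 𝔥 k), ← FGH.smul_def, GHModule.smul_assoc, one_smul]

theorem FGH.δ_const (k : K) : FGH.δ 𝔥 (FGH.const 𝔥 k) = k := by
  change (GFun.const 𝔤 k).1 1 = k
  rw [GFun.const_apply, map_one, mul_one]

theorem Fib.mk_FGH_smul (φ : FGH 𝔥) (v : M) : Fib.mk 𝔥 (φ • v) = FGH.δ 𝔥 φ • Fib.mk 𝔥 v := by
  rw [← Fib.mk_smul, ← sub_eq_zero, ← map_sub, ← FGH.const_smul 𝔥, ← sub_smul, Fib.mk_eq_zero]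
  exact APlus.smul_mem_of_δ (by rw [map_sub, FGH.δ_const, sub_self]) v

/-- The two sides agree at `1`, and both satisfy the Leibniz rule under the action of `𝔤`; hence
they agree on all monomials. -/
theorem deltaFun_smul (φ : FGH 𝔥) (v : M) :
    deltaFun 𝔥 (φ • v) = GFun.conv φ.1 (deltaFun 𝔥 v) := by
  ext u
  induction u using U.induction_left generalizing φ v with
  | hι k =>
    rw [GFun.apply_ι, GFun.apply_ι, GFun.conv_one, deltaFun_one, deltaFun_one, Fib.mk_FGH_smul]
    rfl
  | add u w hu hw => simp only [map_add, hu, hw]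
  | hj i a ha u hu =>
  induction φ using FGH.induction with
  | add φ ψ hφ hψ =>
    rw [add_smul, map_add, Subring.coe_add, GFun.add_conv, AddSubgroup.coe_add, AddSubgroup.coe_add,
      AddMonoidHom.add_apply, AddMonoidHom.add_apply, hφ, hψ]
  | hom n φ hφ =>
  induction v using homog_induction with
  | add v w hv hw =>
    rw [smul_add, map_add, map_add, GFun.conv_add, AddSubgroup.coe_add, AddSubgroup.coe_add,
      AddMonoidHom.add_apply, AddMonoidHom.add_apply, hv, hw]
  | hom l v hv =>
    have hφ' : φ.1 ∈ GFun.gr K 𝔤 K n := hφ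
    have hX := GFun.act_apply_of_mem ha (deltaFun 𝔥 (φ • v)) u
    have hY := GFun.act_apply_of_mem ha (GFun.conv φ.1 (deltaFun 𝔥 v)) u
    rw [← deltaFun_act, GHModule.leibniz v ha hφ, map_add, map_zsmul] at hX
    rw [GFun.act_conv ha hφ', ← deltaFun_act] at hY
    have h : (deltaFun 𝔥 (FGH.act 𝔥 a φ • v) +
          ks i n • deltaFun 𝔥 (φ • LieSuperModule.act K a v)).1 u =
        (GFun.conv (GFun.act a φ.1) (deltaFun 𝔥 v) +
          ks i n • GFun.conv φ.1 (deltaFun 𝔥 (LieSuperModule.act K a v))).1 u := by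
      simp only [AddSubgroup.coe_add, AddSubgroup.coe_zsmul, AddMonoidHom.add_apply,
        AddMonoidHom.smul_apply, hu]
      rfl
    rw [h, hY, GFun.tw_of_mem (deltaFun_mem_gr 𝔥 (GHModule.smul_mem hφ hv)),
      GFun.tw_of_mem (GFun.conv_mem_gr hφ' (deltaFun_mem_gr 𝔥 hv))] at hX
    have h2 := congrArg (fun x => ks i (n + l) • x) (neg_injective hX)
    simp only [AddSubgroup.coe_zsmul, AddMonoidHom.smul_apply, smul_smul, ks_mul_self,
      one_smul] at h2
    exact h2.symm

end DeltaTilde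

/-! ### Order of vanishing at the identity -/

section Order
variable {K 𝔤 N : Type*} [Ring K] [Algebra ℚ K] [SuperGraded K] [SuperCommRing K] [AddCommGroup 𝔤]
  [SuperGraded 𝔤] [Module K 𝔤] [LieSuperalgebra K 𝔤] [AddCommGroup N] [SuperGraded N]
  [Module K N] [SuperModule K N]

namespace GFun

variable (K 𝔤 N) in
/-- The formal functions that vanish to order `n` at the identity, that is, on all products of fewer
than `n` elements of `𝔤`. -/
noncomputable def vanishing : ℕ → AddSubgroup (GFun K 𝔤 N)
  | 0 => ⊤
  | n + 1 =>
    { carrier := {f | f.1 1 = 0 ∧ ∀ i, ∀ a ∈ SuperLie.gr 𝔤 i, L a f ∈ vanishing n}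
      zero_mem' := ⟨rfl, fun i a _ => by rw [map_zero]; exact zero_mem _⟩
      add_mem' := fun {f g} hf hg => ⟨by
        rw [AddSubgroup.coe_add, AddMonoidHom.add_apply, hf.1, hg.1, add_zero],
        fun i a ha => by rw [map_add]; exact add_mem (hf.2 i a ha) (hg.2 i a ha)⟩
      neg_mem' := fun {f} hf => ⟨by
        rw [AddSubgroup.coe_neg, AddMonoidHom.neg_apply, hf.1, neg_zero],
        fun i a ha => by rw [map_neg]; exact neg_mem (hf.2 i a ha)⟩ }

theorem mem_vanishing_zero (f : GFun K 𝔤 N) : f ∈ vanishing K 𝔤 N 0 := trivial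

theorem vanishing_antitone : Antitone (vanishing K 𝔤 N) := by
  refine antitone_nat_of_succ_le fun n => ?_
  induction n with
  | zero => exact fun f _ => mem_vanishing_zero f
  | succ n ih => exact fun f hf => ⟨hf.1, fun i a ha => ih (hf.2 i a ha)⟩

/-- The filtration is separated: each element of `U(𝔤)` is a sum of products of boundedly many
elements of `𝔤`. -/
theorem exists_apply_eq_zero (u : U K 𝔤) : ∃ n, ∀ f ∈ vanishing K 𝔤 N n, f.1 u = 0 := by
  induction u using U.induction_left with
  | hι k => exact ⟨1, fun f hf => by rw [apply_ι, hf.1]; simp [rsmul]⟩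
  | add u v hu hv =>
    obtain ⟨m, hm⟩ := hu
    obtain ⟨n, hn⟩ := hv
    refine ⟨max m n, fun f hf => ?_⟩
    rw [map_add, hm f (vanishing_antitone (le_max_left m n) hf),
      hn f (vanishing_antitone (le_max_right m n) hf), add_zero]
  | hj i a ha u hu =>
    obtain ⟨n, hn⟩ := hu
    exact ⟨n + 1, fun f hf => hn _ (hf.2 i a ha)⟩

theorem eq_zero_of_forall_vanishing {f : GFun K 𝔤 N} (h : ∀ n, f ∈ vanishing K 𝔤 N n) :
    f = 0 := by
  ext u
  obtain ⟨n, hn⟩ := exists_apply_eq_zero (N := N) u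
  exact hn f (h n)

/-- The functions that vanish to order `n` are closed for pointwise convergence. -/
theorem mem_vanishing_of_forall_exists {n : ℕ} {f : GFun K 𝔤 N}
    (h : ∀ u, ∃ g ∈ vanishing K 𝔤 N n, f.1 u = g.1 u) : f ∈ vanishing K 𝔤 N n := by
  induction n generalizing f with
  | zero => exact mem_vanishing_zero f
  | succ n ih =>
    refine ⟨?_, fun i a ha => ih fun u => ?_⟩
    · obtain ⟨g, hg, h1⟩ := h 1
      rw [h1, hg.1]
    · obtain ⟨g, hg, h1⟩ := h (U.j K 𝔤 a * u)
      exact ⟨L a g, hg.2 i a ha, h1⟩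

/-- `F(G, N)` is complete for the filtration by the order of vanishing. -/
theorem exists_limit (s : ℕ → GFun K 𝔤 N) (hs : ∀ n, s (n + 1) - s n ∈ vanishing K 𝔤 N n) :
    ∃ f : GFun K 𝔤 N, ∀ n, f - s n ∈ vanishing K 𝔤 N n := by
  have hle : ∀ m n, m ≤ n → s n - s m ∈ vanishing K 𝔤 N m := by
    intro m n h
    induction n, h using Nat.le_induction with
    | base => rw [sub_self]; exact zero_mem _
    | succ n h ih =>
      rw [← sub_add_sub_cancel _ (s n)]
      exact add_mem (vanishing_antitone h (hs n)) ih
  choose d hd using exists_apply_eq_zero (K := K) (𝔤 := 𝔤) (N := N)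
  have key : ∀ u n, d u ≤ n → (s n).1 u = (s (d u)).1 u := by
    intro u n h
    have := hd u _ (hle _ _ h)
    rwa [AddSubgroup.coe_sub, AddMonoidHom.sub_apply, sub_eq_zero] at this
  -- The values `s n u` are constant for `n ≥ d u`; this is the value of the limit.
  let f : GFun K 𝔤 N := ⟨AddMonoidHom.mk' (fun u => (s (d u)).1 u) fun u v => by
      rw [← key (u + v) (max (d (u + v)) (max (d u) (d v))) (by omega),
        ← key u (max (d (u + v)) (max (d u) (d v))) (by omega),
        ← key v (max (d (u + v)) (max (d u) (d v))) (by omega), map_add],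
    fun u k => by
      change (s (d (u * U.ι K 𝔤 k))).1 (u * U.ι K 𝔤 k) = rsmul ((s (d u)).1 u) k
      rw [← key (u * U.ι K 𝔤 k) (max (d (u * U.ι K 𝔤 k)) (d u)) (by omega),
        ← key u (max (d (u * U.ι K 𝔤 k)) (d u)) (by omega), apply_mul_ι]⟩
  refine ⟨f, fun n => mem_vanishing_of_forall_exists fun u => ?_⟩
  refine ⟨s (max (d u) n) - s n, hle _ _ (le_max_right _ _), ?_⟩
  rw [AddSubgroup.coe_sub, AddSubgroup.coe_sub, AddMonoidHom.sub_apply, AddMonoidHom.sub_apply,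
    key u _ (le_max_left _ _)]
  rfl

theorem conv_mem_vanishing {n : ℕ} {φ : GFun K 𝔤 K} (hφ : φ ∈ vanishing K 𝔤 K n)
    (f : GFun K 𝔤 N) : conv φ f ∈ vanishing K 𝔤 N n := by
  induction n generalizing φ f with
  | zero => exact mem_vanishing_zero _
  | succ n ih =>
    refine ⟨by rw [conv_one, hφ.1, zero_smul], fun i a ha => ?_⟩
    rw [L_conv ha]
    exact add_mem (ih (hφ.2 i a ha) _) (ih (vanishing_antitone n.le_succ hφ) _)

theorem sum_apply {ι : Type*} [Fintype ι] (f : ι → GFun K 𝔤 N) (u : U K 𝔤) :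
    (∑ i, f i).1 u = ∑ i, (f i).1 u := by
  rw [AddSubgroup.val_finsetSum, AddMonoidHom.finsetSum_apply]

theorem tw_apply_one (i : ZMod 2) (f : GFun K 𝔤 N) : (tw i f).1 1 = twist i (f.1 1) := by
  rw [tw_apply, twist_of_mem _ U.one_mem, ks_zero_right, one_smul]

theorem linearIndependent_tw {ι : Type*} [Fintype ι] {e : ι → GFun K 𝔤 N}
    (he : LinearIndependent K fun i => (e i).1 1) (l : ZMod 2) :
    LinearIndependent K fun i => (tw l (e i)).1 1 := by
  rw [Fintype.linearIndependent_iff] at he ⊢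
  intro k hk i
  have h := he (fun i => twist l (k i)) (by
    rw [← map_zero (twist l), ← hk, map_sum]
    refine Finset.sum_congr rfl fun i _ => ?_
    rw [tw_apply_one, twist_smul, twist_twist]) i
  rw [← twist_twist l (k i), h, map_zero]

/-! ### Expansion of vector-valued functions -/

variable {ι : Type*} [Fintype ι]

/-- Coefficients with respect to functions whose values at the identity are linearly independent
are unique, and they vanish to the same order as the combination. -/
theorem mem_vanishing_of_sum_conv_mem {n : ℕ} {φ : ι → GFun K 𝔤 K} {e : ι → GFun K 𝔤 N}
    (he : LinearIndependent K fun i => (e i).1 1)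
    (h : ∑ i, conv (φ i) (e i) ∈ vanishing K 𝔤 N n) (i : ι) : φ i ∈ vanishing K 𝔤 K n := by
  induction n generalizing φ e i with
  | zero => exact mem_vanishing_zero _
  | succ n ih =>
    refine ⟨?_, fun l a ha => ?_⟩
    · refine Fintype.linearIndependent_iff.1 he (fun i => (φ i).1 1) ?_ i
      rw [← h.1, sum_apply]
      exact Finset.sum_congr rfl fun i _ => (conv_one _ _).symm
    -- The left derivative of the combination has the coefficients `L a (φ i)` with respect to the
    -- functions `tw l (e i)`, up to terms that vanish to order `n` by induction.
    · have hL := h.2 l a ha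
      simp only [map_sum, L_conv ha, Finset.sum_add_distrib] at hL
      refine ih (linearIndependent_tw he l) ((add_mem_cancel_right (sum_mem fun i _ => ?_)).1 hL) i
      exact conv_mem_vanishing (ih he (vanishing_antitone n.le_succ h) i) _

theorem eq_zero_of_sum_conv_eq_zero {φ : ι → GFun K 𝔤 K} {e : ι → GFun K 𝔤 N}
    (he : LinearIndependent K fun i => (e i).1 1) (h : ∑ i, conv (φ i) (e i) = 0) (i : ι) :
    φ i = 0 :=
  eq_zero_of_forall_vanishing fun _ =>
    mem_vanishing_of_sum_conv_mem he (by rw [h]; exact zero_mem _) i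

theorem sum_rsmul (x : ι → N) (k : K) : rsmul (∑ i, x i) k = ∑ i, rsmul (x i) k :=
  map_sum (AddMonoidHom.mk' (fun x : N => rsmul x k) fun x y => add_rsmul x y k) x _

theorem coord_rsmul (B : Module.Basis ι K N) {p : ι → ZMod 2}
    (hB : ∀ i, B i ∈ SuperLie.gr N (p i)) (i : ι) (x : N) (k : K) :
    B.coord i (rsmul x (twist (p i) k)) = B.coord i x * k := by
  classical
  induction k using homog_induction with
  | add k k' hk hk' => simp only [map_add, rsmul_add, mul_add, hk, hk']
  | hom l k hk =>
    have h : rsmul x (twist (p i) k) =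
        ∑ j, (B.coord j x * ((ks (p j) l * ks (p i) l) • k)) • B j := by
      conv_lhs => rw [← B.sum_repr x]
      rw [sum_rsmul]
      refine Finset.sum_congr rfl fun j _ => ?_
      rw [smul_rsmul, rsmul_homog (hB j) (twist_mem _ hk), twist_of_mem _ hk, mul_smul, mul_smul,
        ← smul_assoc (ks (p j) l)]
      rfl
    rw [Module.Basis.coord_apply, h, B.repr_sum_self, ks_mul_self, one_smul]

/-- The coordinates of a function with values in a free module. The sign that is needed for a
coordinate to be right `K`-linear comes from the parity of the basis vector. -/
noncomputable def coord (B : Module.Basis ι K N) {p : ι → ZMod 2}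
    (hB : ∀ i, B i ∈ SuperLie.gr N (p i)) (i : ι) : GFun K 𝔤 N →+ GFun K 𝔤 K :=
  AddMonoidHom.mk' (fun f => ⟨(B.coord i).toAddMonoidHom.comp (f.1.comp (twist (p i))),
    fun u k => by
      change B.coord i (f.1 (twist (p i) (u * U.ι K 𝔤 k))) =
        rsmul (B.coord i (f.1 (twist (p i) u))) k
      rw [U.twist_mul, twist_ι, apply_mul_ι, coord_rsmul B hB, rsmul_eq_mul]⟩)
    fun f g => by ext u; simp

theorem coord_apply (B : Module.Basis ι K N) {p : ι → ZMod 2}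
    (hB : ∀ i, B i ∈ SuperLie.gr N (p i)) (i : ι) (f : GFun K 𝔤 N) (u : U K 𝔤) :
    (coord B hB i f).1 u = B.coord i (f.1 (twist (p i) u)) := rfl

theorem coord_one (B : Module.Basis ι K N) {p : ι → ZMod 2}
    (hB : ∀ i, B i ∈ SuperLie.gr N (p i)) (i : ι) (f : GFun K 𝔤 N) :
    (coord B hB i f).1 1 = B.repr (f.1 1) i := by
  rw [coord_apply, twist_of_mem _ U.one_mem, ks_zero_right, one_smul, Module.Basis.coord_apply]

theorem L_coord (B : Module.Basis ι K N) {p : ι → ZMod 2}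
    (hB : ∀ i, B i ∈ SuperLie.gr N (p i)) (i : ι) (f : GFun K 𝔤 N) {l : ZMod 2} {a : 𝔤}
    (ha : a ∈ SuperLie.gr 𝔤 l) :
    L a (coord B hB i f) = ks (p i) l • coord B hB i (L a f) := by
  ext u
  change (coord B hB i f).1 (U.j K 𝔤 a * u) = ks (p i) l • (coord B hB i (L a f)).1 u
  rw [coord_apply, coord_apply, U.twist_mul, twist_of_mem _ (U.j_mem ha), smul_mul_assoc, map_zsmul,
    map_zsmul, L_apply]

theorem coord_mem_vanishing (B : Module.Basis ι K N) {p : ι → ZMod 2}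
    (hB : ∀ i, B i ∈ SuperLie.gr N (p i)) (i : ι) {n : ℕ} {f : GFun K 𝔤 N}
    (hf : f ∈ vanishing K 𝔤 N n) : coord B hB i f ∈ vanishing K 𝔤 K n := by
  induction n generalizing f with
  | zero => exact mem_vanishing_zero _
  | succ n ih =>
    refine ⟨by rw [coord_one, hf.1, map_zero]; rfl, fun l a ha => ?_⟩
    rw [L_coord B hB i f ha]
    exact zsmul_mem (ih (hf.2 l a ha)) _

/-- A function is given to leading order by its coordinates, with respect to any functions `e i`
whose values at the identity form the basis. -/
theorem sub_sum_conv_mem_vanishing (B : Module.Basis ι K N) {p : ι → ZMod 2}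
    (hB : ∀ i, B i ∈ SuperLie.gr N (p i)) {e : ι → GFun K 𝔤 N} (he : ∀ i, (e i).1 1 = B i)
    {n : ℕ} {f : GFun K 𝔤 N} (hf : f ∈ vanishing K 𝔤 N n) :
    f - ∑ i, conv (coord B hB i f) (e i) ∈ vanishing K 𝔤 N (n + 1) := by
  induction n generalizing e f with
  | zero =>
    refine ⟨?_, fun _ _ _ => mem_vanishing_zero _⟩
    rw [AddSubgroup.coe_sub, AddMonoidHom.sub_apply, sum_apply, sub_eq_zero]
    simp only [conv_one, coord_one, he]
    exact (B.sum_repr _).symm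
  | succ n ih =>
    refine ⟨(ih he (vanishing_antitone n.le_succ hf)).1, fun l a ha => ?_⟩
    -- The sign of `L_coord` is absorbed into `e i`, which keeps the value at the identity.
    have he' : ∀ i, (ks (p i) l • tw l (e i)).1 1 = B i := fun i => by
      rw [AddSubgroup.coe_zsmul, AddMonoidHom.smul_apply, tw_apply_one, he, twist_of_mem _ (hB i),
        smul_smul, ks_comm l, ks_mul_self, one_smul]
    have h : L a (f - ∑ i, conv (coord B hB i f) (e i)) =
        (L a f - ∑ i, conv (coord B hB i (L a f)) (ks (p i) l • tw l (e i))) -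
          ∑ i, conv (coord B hB i f) (L a (e i)) := by
      simp only [map_sub, map_sum, L_conv ha, L_coord B hB _ f ha, zsmul_conv, conv_zsmul,
        Finset.sum_add_distrib, sub_sub]
    rw [h]
    exact sub_mem (ih he' (hf.2 l a ha))
      (sum_mem fun i _ => conv_mem_vanishing (coord_mem_vanishing B hB i hf) _)

/-- Functions `e i` whose values at the identity form a homogeneous basis of `N` generate `F(G, N)`
over `F(G)`: the coefficients are found by successive approximation. -/
theorem exists_eq_sum_conv (B : Module.Basis ι K N) {p : ι → ZMod 2}
    (hB : ∀ i, B i ∈ SuperLie.gr N (p i)) {e : ι → GFun K 𝔤 N} (he : ∀ i, (e i).1 1 = B i)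
    (f : GFun K 𝔤 N) : ∃ φ : ι → GFun K 𝔤 K, f = ∑ i, conv (φ i) (e i) := by
  -- The remainder after `n` steps.
  let r : ℕ → GFun K 𝔤 N := fun n =>
    n.rec f fun _ g => g - ∑ i, conv (coord B hB i g) (e i)
  have hr : ∀ n, r n ∈ vanishing K 𝔤 N n := by
    intro n
    induction n with
    | zero => exact mem_vanishing_zero _
    | succ n ih => exact sub_sum_conv_mem_vanishing B hB he ih
  let s : ι → ℕ → GFun K 𝔤 K := fun i n => ∑ m ∈ Finset.range n, coord B hB i (r m)
  have hs : ∀ n, f - ∑ i, conv (s i n) (e i) = r n := by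
    intro n
    induction n with
    | zero => simp [s, r, zero_conv]
    | succ n ih =>
      change _ = r n - ∑ i, conv (coord B hB i (r n)) (e i)
      simp only [s, Finset.sum_range_succ, add_conv, Finset.sum_add_distrib]
      rw [← ih, sub_sub]
  choose φ hφ using fun i => exists_limit (s i) fun n => by
    simp only [s, Finset.sum_range_succ, add_sub_cancel_left]
    exact coord_mem_vanishing B hB i (hr n)
  refine ⟨φ, sub_eq_zero.1 (eq_zero_of_forall_vanishing fun n => ?_)⟩
  have h : f - ∑ i, conv (φ i) (e i) = r n - ∑ i, conv (φ i - s i n) (e i) := by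
    rw [← hs, sub_sub, ← Finset.sum_add_distrib]
    simp only [← add_conv, add_sub_cancel]
  rw [h]
  exact sub_mem (hr n) (sum_mem fun i _ => conv_mem_vanishing (hφ i n) _)

/-! ### Right derivatives and `𝔥`-equivariant functions -/

/-- The derivative `f ↦ (u ↦ (-1)^(p(a) p(u)) f(u j(a)))` of a function along the invariant vector
field given by right multiplication by `a`. -/
noncomputable def R {i : ZMod 2} {a : 𝔤} (ha : a ∈ SuperLie.gr 𝔤 i) :
    GFun K 𝔤 N →+ GFun K 𝔤 N :=
  AddMonoidHom.mk' (fun f => ⟨f.1.comp ((AddMonoidHom.mulRight (U.j K 𝔤 a)).comp (twist i)),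
    fun u k => by
      change f.1 (twist i (u * U.ι K 𝔤 k) * U.j K 𝔤 a) = rsmul (f.1 (twist i u * U.j K 𝔤 a)) k
      rw [← apply_mul_ι, U.twist_mul, twist_ι, mul_assoc, mul_assoc]
      congr 2
      induction k using homog_induction with
      | add k k' hk hk' => simp only [map_add, mul_add, add_mul, hk, hk']
      | hom l k hk => rw [twist_of_mem _ hk, U.j_mul_ι ha hk, map_zsmul, smul_mul_assoc]⟩)
    fun f g => by ext u; simp

theorem R_apply {i : ZMod 2} {a : 𝔤} (ha : a ∈ SuperLie.gr 𝔤 i) (f : GFun K 𝔤 N) (u : U K 𝔤) :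
    (R ha f).1 u = f.1 (twist i u * U.j K 𝔤 a) := rfl

theorem R_one {i : ZMod 2} {a : 𝔤} (ha : a ∈ SuperLie.gr 𝔤 i) (f : GFun K 𝔤 N) :
    (R ha f).1 1 = f.1 (U.j K 𝔤 a) := by
  rw [R_apply, twist_of_mem _ U.one_mem, ks_zero_right, one_smul, one_mul]

theorem L_R {i l : ZMod 2} {a b : 𝔤} (ha : a ∈ SuperLie.gr 𝔤 i) (hb : b ∈ SuperLie.gr 𝔤 l)
    (f : GFun K 𝔤 N) : L b (R ha f) = ks i l • R ha (L b f) := by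
  ext u
  change f.1 (twist i (U.j K 𝔤 b * u) * U.j K 𝔤 a) =
    ks i l • f.1 (U.j K 𝔤 b * (twist i u * U.j K 𝔤 a))
  rw [U.twist_mul, twist_of_mem _ (U.j_mem hb), smul_mul_assoc, smul_mul_assoc, map_zsmul,
    mul_assoc]

theorem R_tw {i : ZMod 2} {a : 𝔤} (ha : a ∈ SuperLie.gr 𝔤 i) (l : ZMod 2) (f : GFun K 𝔤 N) :
    R ha (tw l f) = ks l i • tw l (R ha f) := by
  ext u
  change twist l (f.1 (twist l (twist i u * U.j K 𝔤 a))) =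
    ks l i • twist l (f.1 (twist i (twist l u) * U.j K 𝔤 a))
  rw [U.twist_mul, twist_of_mem _ (U.j_mem ha), mul_smul_comm, map_zsmul, map_zsmul, ← twist_add,
    ← twist_add, add_comm]

/-- The Leibniz rule for right derivatives. -/
theorem R_conv {i : ZMod 2} {a : 𝔤} (ha : a ∈ SuperLie.gr 𝔤 i) (φ : GFun K 𝔤 K)
    (f : GFun K 𝔤 N) : R ha (conv φ f) = conv (R ha φ) (tw i f) + conv φ (R ha f) := by
  ext u
  induction u using U.induction_left generalizing φ f with
  | hι k =>
    have h := conv_j_mul φ f ha 1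
    rw [mul_one, conv_one, conv_one, L_apply, L_apply, mul_one] at h
    rw [apply_ι, apply_ι, R_one, h, AddSubgroup.coe_add, AddMonoidHom.add_apply, conv_one, conv_one,
      R_one, R_one]
  | add u v hu hv => rw [map_add, map_add, hu, hv]
  | hj l b hb u hu =>
    rw [← L_apply, ← L_apply, L_R ha hb, L_conv hb, map_add, map_add, L_conv hb, L_conv hb,
      L_R ha hb, L_R ha hb]
    simp only [AddSubgroup.coe_zsmul, AddSubgroup.coe_add, AddMonoidHom.smul_apply,
      AddMonoidHom.add_apply, hu]
    rw [L_tw hb, R_tw ha, tw_tw, tw_tw, add_comm l i]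
    simp only [zsmul_conv, conv_zsmul, AddSubgroup.coe_zsmul, AddMonoidHom.smul_apply, smul_add,
      smul_smul, ks_comm l i, ks_mul_self, one_smul]
    abel

end GFun
end Order

section Coinduced
variable {K 𝔤 V : Type*} [Ring K] [Algebra ℚ K] [SuperGraded K] [SuperCommRing K] [AddCommGroup 𝔤]
  [SuperGraded 𝔤] [Module K 𝔤] [LieSuperalgebra K 𝔤] {𝔥 : LieSuperSubalgebra K 𝔤}
  [AddCommGroup V] [SuperGraded V] [Module K V] [SuperModule K V]
  [LieSuperModule K 𝔥.toSubmodule V]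

theorem act_rsmul {i : ZMod 2} {a : 𝔥.toSubmodule} (ha : a ∈ gr 𝔥.toSubmodule i) (m : V) (k : K) :
    LieSuperModule.act K a (rsmul m k) = rsmul (LieSuperModule.act K a m) k := by
  induction k using homog_induction with
  | add k k' hk hk' => simp only [rsmul_add, map_add, hk, hk']
  | hom l k hk =>
    rw [rsmul_twist _ hk, rsmul_twist _ hk, LieSuperModule.act_smul _ hk ha, twist_act ha,
      smul_comm]

namespace GFun

/-- The action of `a ∈ 𝔥` on the values of a function:
`f ↦ (u ↦ (-1)^(p(a) p(f)) a (f u))`. -/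
noncomputable def valueAct {i : ZMod 2} {a : 𝔥.toSubmodule} (ha : a ∈ SuperLie.gr 𝔥.toSubmodule i) :
    GFun K 𝔤 V →+ GFun K 𝔤 V :=
  AddMonoidHom.mk' (fun f => ⟨(LieSuperModule.act K a).comp (tw i f).1, fun u k => by
    change LieSuperModule.act K a ((tw i f).1 (u * U.ι K 𝔤 k)) =
      rsmul (LieSuperModule.act K a ((tw i f).1 u)) k
    rw [apply_mul_ι, act_rsmul ha]⟩)
    fun f g => by ext u; simp

theorem valueAct_apply {i : ZMod 2} {a : 𝔥.toSubmodule} (ha : a ∈ SuperLie.gr 𝔥.toSubmodule i)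
    (f : GFun K 𝔤 V) (u : U K 𝔤) :
    (valueAct ha f).1 u = LieSuperModule.act K a ((tw i f).1 u) := rfl

theorem tw_valueAct {i : ZMod 2} {a : 𝔥.toSubmodule} (ha : a ∈ SuperLie.gr 𝔥.toSubmodule i)
    (l : ZMod 2) (f : GFun K 𝔤 V) : tw l (valueAct ha f) = ks l i • valueAct ha (tw l f) := by
  ext u
  change twist l (LieSuperModule.act K a ((tw i f).1 (twist l u))) =
    ks l i • LieSuperModule.act K a ((tw i (tw l f)).1 u)
  rw [twist_act ha, tw_tw, add_comm, ← tw_tw, tw_apply l]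

theorem conv_valueAct {i : ZMod 2} {a : 𝔥.toSubmodule} (ha : a ∈ SuperLie.gr 𝔥.toSubmodule i)
    (φ : GFun K 𝔤 K) (f : GFun K 𝔤 V) : conv φ (valueAct ha f) = valueAct ha (conv φ f) := by
  ext u
  rw [valueAct_apply, tw_conv, conv_apply, conv_apply]
  induction coprod K 𝔤 u using UU.induction with
  | add x y hx hy => simp only [map_add, hx, hy]
  | tmul l n u hu v hv =>
    rw [pair_mk, pair_mk, pairZ_tmul _ _ hu, pairZ_tmul _ _ hu, tw_valueAct ha, tw_tw, tw_apply i φ,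
      act_twist_smul ha, twist_of_mem _ hu, map_zsmul, smul_assoc, add_comm l i, ← tw_tw,
      AddSubgroup.coe_zsmul, AddMonoidHom.smul_apply, valueAct_apply, smul_comm, ks_comm]

theorem mem_Coind_iff {f : GFun K 𝔤 V} : f ∈ Coind 𝔥 V ↔
    ∀ i, ∀ (a : 𝔥.toSubmodule) (ha : a ∈ SuperLie.gr 𝔥.toSubmodule i),
      R (𝔥.mem_gr.1 ha) f = -valueAct ha f := by
  refine ⟨fun hf i a ha => ?_, fun hf i a ha u => ?_⟩
  · ext u
    rw [R_apply, hf i a ha]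
    rfl
  · have h := congrArg (fun g => g.1 (twist i u)) (hf i a ha)
    simp only [R_apply, twist_twist] at h
    rw [h]
    change -LieSuperModule.act K a (twist i (f.1 (twist i (twist i u)))) = _
    rw [twist_twist]

/-- The coefficients of a combination of `𝔥`-equivariant functions that is again `𝔥`-equivariant are
invariant under `𝔥`, since their right derivatives are the coefficients of zero. -/
theorem mem_FGH_of_sum_conv_mem_Coind {ι : Type*} [Fintype ι] {φ : ι → GFun K 𝔤 K}
    {e : ι → GFun K 𝔤 V} (he : LinearIndependent K fun i => (e i).1 1)
    (heC : ∀ i, e i ∈ Coind 𝔥 V) (h : ∑ i, conv (φ i) (e i) ∈ Coind 𝔥 V) (i : ι) :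
    φ i ∈ FGH 𝔥 := by
  have key : ∀ l, ∀ b ∈ SuperLie.gr 𝔤 l, b ∈ 𝔥.toSubmodule → ∀ u,
      (φ i).1 (u * U.j K 𝔤 b) = 0 := by
    intro l b hb hbh u
    have hb' : (⟨b, hbh⟩ : 𝔥.toSubmodule) ∈ SuperLie.gr 𝔥.toSubmodule l := hb
    have h1 := mem_Coind_iff.1 h l _ hb'
    simp only [map_sum, R_conv, Finset.sum_add_distrib, ← conv_valueAct,
      fun i => mem_Coind_iff.1 (heC i) l _ hb'] at h1
    have h2 : ∀ i, conv (φ i) (-valueAct hb' (e i)) = -conv (φ i) (valueAct hb' (e i)) :=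
      fun i => (convHom (φ i)).map_neg _
    simp only [h2, Finset.sum_neg_distrib, add_eq_right] at h1
    have h3 := eq_zero_of_sum_conv_eq_zero (linearIndependent_tw he l) h1 i
    rw [← twist_twist l u, ← R_apply (𝔥.mem_gr.1 hb'), h3]
    rfl
  intro b hb u
  rw [comp_right, key 0 _ (comp_mem _ _) (𝔥.comp_mem 0 hb) u,
    key 1 _ (comp_mem _ _) (𝔥.comp_mem 1 hb) u, add_zero]

end GFun
end Coinduced

/-! ### The fibre, and bijectivity of `δ̃` -/

section FibreBasis
variable {K 𝔤 : Type*} [Ring K] [Algebra ℚ K] [SuperGraded K] [SuperCommRing K] [AddCommGroup 𝔤]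
  [SuperGraded 𝔤] [Module K 𝔤] [LieSuperalgebra K 𝔤] (𝔥 : LieSuperSubalgebra K 𝔤) {M : Type*}
  [AddCommGroup M] [SuperGraded M] [Module K M] [SuperModule K M] [LieSuperModule K 𝔤 M]
  [Module (FGH 𝔥) M]

theorem APlus.δ_repr_eq_zero {ι : Type*} (b : Module.Basis ι (FGH 𝔥) M) {m : M}
    (hm : m ∈ APlus 𝔥 M) (i : ι) : FGH.δ 𝔥 (b.repr m i) = 0 := by
  induction hm using Submodule.span_induction with
  | mem x hx =>
    obtain ⟨φ, hφ, m, rfl⟩ := hx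
    rw [map_smul, Finsupp.smul_apply, smul_eq_mul, map_mul, hφ, zero_mul]
  | zero => rw [map_zero, Finsupp.zero_apply, map_zero]
  | add x y _ _ hx hy => rw [map_add, Finsupp.add_apply, map_add, hx, hy, add_zero]
  | smul φ x _ hx => rw [map_smul, Finsupp.smul_apply, smul_eq_mul, map_mul, hx, mul_zero]

variable [GHModule 𝔥 M] {ι : Type*} [Fintype ι]

/-- A basis of `M` over `F(G/H)` induces a basis of the fibre over `K`. -/
theorem Fib.exists_basis (b : Module.Basis ι (FGH 𝔥) M) :
    ∃ B : Module.Basis ι K (Fib 𝔥 M), ∀ i, B i = Fib.mk 𝔥 (b i) := by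
  classical
  have hli : LinearIndependent K fun i => Fib.mk 𝔥 (b i) := by
    rw [Fintype.linearIndependent_iff]
    intro k hk i
    have h : Fib.mk 𝔥 (∑ i, FGH.const 𝔥 (k i) • b i) = 0 := by
      rw [map_sum, ← hk]
      refine Finset.sum_congr rfl fun i _ => ?_
      rw [Fib.mk_FGH_smul, FGH.δ_const]
    have h2 := APlus.δ_repr_eq_zero 𝔥 b (Fib.mk_eq_zero.1 h) i
    rwa [b.repr_sum_self, FGH.δ_const] at h2
  have hsp : ⊤ ≤ Submodule.span K (Set.range fun i => Fib.mk 𝔥 (b i)) := by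
    intro x _
    obtain ⟨m, rfl⟩ := Fib.mk_surjective 𝔥 x
    rw [← b.sum_repr m, map_sum]
    refine Submodule.sum_mem _ fun i _ => ?_
    rw [Fib.mk_FGH_smul]
    exact Submodule.smul_mem _ _ (Submodule.subset_span ⟨i, rfl⟩)
  exact ⟨Module.Basis.mk hli hsp, fun i => Module.Basis.mk_apply hli hsp i⟩

/-- The map `δ̃` as a morphism of modules over `F(G/H)`. -/
noncomputable def deltaLinear : M →ₗ[FGH 𝔥] Coind 𝔥 (Fib 𝔥 M) where
  toFun v := ⟨deltaFun 𝔥 v, deltaFun_mem_Coind 𝔥 v⟩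
  map_add' v w := Subtype.ext (map_add (deltaFun 𝔥) v w)
  map_smul' φ v := Subtype.ext (deltaFun_smul 𝔥 φ v)

theorem deltaLinear_coe (v : M) : (deltaLinear 𝔥 v).1 = deltaFun 𝔥 v := rfl

theorem deltaFun_sum (b : ι → M) (φ : ι → FGH 𝔥) :
    deltaFun 𝔥 (∑ i, φ i • b i) = ∑ i, GFun.conv (φ i).1 (deltaFun 𝔥 (b i)) := by
  simp only [map_sum, deltaFun_smul]

theorem deltaLinear_bijective (h : IsFreeOfFiniteRank 𝔥 M) :
    Function.Bijective (deltaLinear 𝔥 (M := M)) := by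
  obtain ⟨n, b, hb⟩ := h
  choose p hp using hb
  obtain ⟨B, hB⟩ := Fib.exists_basis 𝔥 b
  have hBp : ∀ i, B i ∈ gr (Fib 𝔥 M) (p i) := fun i => by rw [hB]; exact Fib.mk_mem (hp i)
  have he : ∀ i, (deltaFun 𝔥 (b i)).1 1 = B i := fun i => by rw [deltaFun_one, hB]
  have hli : LinearIndependent K fun i => (deltaFun 𝔥 (b i)).1 1 := by
    simp only [he]
    exact B.linearIndependent
  refine ⟨(injective_iff_map_eq_zero _).2 fun v hv => ?_, fun f => ?_⟩
  · have h0 : deltaFun 𝔥 v = 0 := congrArg Subtype.val hv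
    rw [← b.sum_repr v, deltaFun_sum] at h0
    rw [← b.sum_repr v]
    refine Finset.sum_eq_zero fun i _ => ?_
    have hi : b.repr v i = 0 := Subtype.ext (GFun.eq_zero_of_sum_conv_eq_zero hli h0 i)
    rw [hi, zero_smul]
  · obtain ⟨φ, hφ⟩ := GFun.exists_eq_sum_conv B hBp he f.1
    have hA : ∀ i, φ i ∈ FGH 𝔥 := GFun.mem_FGH_of_sum_conv_mem_Coind hli
      (fun i => deltaFun_mem_Coind 𝔥 (b i)) (by rw [← hφ]; exact f.2)
    refine ⟨∑ i, (⟨φ i, hA i⟩ : FGH 𝔥) • b i, Subtype.ext ?_⟩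
    rw [deltaLinear_coe, deltaFun_sum, hφ]

end FibreBasis
end SuperLie

theorem mainTheorem11
    {K : Type*} [Ring K] [Algebra ℚ K] [SuperLie.SuperGraded K] [SuperLie.SuperCommRing K]
    {𝔤 : Type*} [AddCommGroup 𝔤] [SuperLie.SuperGraded 𝔤] [Module K 𝔤]
    [SuperLie.LieSuperalgebra K 𝔤]
    (𝔥 : SuperLie.LieSuperSubalgebra K 𝔤)
    (h𝔥 : ∃ 𝔮 : Submodule K 𝔤, Submodule.IsHomogeneous 𝔮 (SuperLie.gr 𝔤) ∧
      IsCompl 𝔥.toSubmodule 𝔮)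
    (𝒱 : Type*) [AddCommGroup 𝒱] [SuperLie.SuperGraded 𝒱] [Module K 𝒱] [SuperLie.SuperModule K 𝒱]
    [SuperLie.LieSuperModule K 𝔤 𝒱] [Module (SuperLie.FGH 𝔥) 𝒱] [SuperLie.GHModule 𝔥 𝒱]
    (h𝒱 : SuperLie.IsFreeOfFiniteRank 𝔥 𝒱) :
    ∃ e : 𝒱 ≃ₗ[SuperLie.FGH 𝔥] SuperLie.Coind 𝔥 (SuperLie.Fib 𝔥 𝒱),
      (∀ v, (e v).1.1 = SuperLie.deltaTilde 𝔥 v) ∧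
      (∀ (k : K) (v : 𝒱), e (k • v) = k • e v) ∧
      (∀ (a : 𝔤) (v : 𝒱),
        e (SuperLie.LieSuperModule.act K a v) = SuperLie.LieSuperModule.act K a (e v)) ∧
      (∀ (i : ZMod 2), ∀ v ∈ SuperLie.gr 𝒱 i,
        e v ∈ SuperLie.gr (SuperLie.Coind 𝔥 (SuperLie.Fib 𝔥 𝒱)) i) := by
  refine ⟨LinearEquiv.ofBijective (SuperLie.deltaLinear 𝔥) (SuperLie.deltaLinear_bijective 𝔥 h𝒱),
    fun v => rfl, fun k v => ?_, fun a v => Subtype.ext (SuperLie.deltaFun_act 𝔥 a v),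
    fun i v hv => SuperLie.deltaFun_mem_gr 𝔥 hv⟩
  rw [← SuperLie.FGH.const_smul 𝔥, map_smul]
  rfl
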